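/- Let $\bar m=(m_i)_{i\ge1}$ be a bounded sequence of positive integers, and let $\mathbb T_{\bar m}$ be the rooted tree in which every vertex of level $i-1$ has $m_i$ children. Vertices of level $n$ are words of $n$ letters, the $i$-th letter away from the root lying in $\{0,\dots,m_i-1\}$; $\mathbb T^n$ denotes the set of vertices of level $n$, and $V_n=m_1\cdots m_n$ its size. For an automorphism $g$ fixing the root and $w\in\mathbb T^n$, the section $g|_w$ is the automorphism that $g$ induces from the subtree above $w$ to the subtree above the image of $w$, both subtrees being identified with the rooted tree with valencies $(m_{n+1},m_{n+2},\dots)$. The $0$-ray consists of the vertices all of whose letters are $0$; its neighbours are the vertices not on the ray whose parent is on the ray. An automorphism is rooted if all its sections at vertices of level $1$ are trivial; it is directed if it fixes the $0$-ray and has trivial sections at all vertices that are neither on the $0$-ray nor neighbours of it. Let $\mathcal A$ be a finite group of directed automorphisms, $\mathcal B$ a group of rooted automorphisms, and $\mathcal M(\mathcal A,\mathcal B)=\langle\mathcal A\cup\mathcal B\rangle$. Let $\mathcal A_n$ be the group generated by the sections of elements of $\mathcal A$ at the vertex of level $n$ of the $0$-ray; for $n\ge1$ let $\mathcal B_n$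 be the group generated by the sections of elements of $\mathcal A$ at the neighbours of level $n$ of the $0$-ray, and let $\mathcal B_0=\mathcal B$. Let $S\subset\mathcal M(\mathcal A,\mathcal B)$ be finite and symmetric. Call a pair of disjoint sets $\mathbb A,\mathbb B\subset\mathbb T^n$ admissible at level $n$ if for every $s\in S$ one has $s|_w\in\mathcal A_n$ for $w\in\mathbb A$, $s|_w\in\mathcal B_n$ for $w\in\mathbb B$, and $s|_w$ trivial for all other $w\in\mathbb T^n$. Let $\Gamma_n$ be the Schreier graph of the action of $\langle S\rangle$ on $\mathbb T^n$ with generating set $S$ (all edges having conductance $1$), and let $\operatorname{Res}_{\Gamma_n}(\mathbb A,\mathbb B)\in(0,\infty]$ be the effective resistance in it between $\mathbb A$ and $\mathbb B$, equal to $\infty$ if no path joins them (and then $k/\infty=0$). Then: (i) There are $n_0$ and a set $F\subset\mathbb T^{n_0}$ such that for every $n>n_0$ the following pair is admissible at level $n$: $\mathbb A_n$ is the set of vertices obtained by continuing a vertex $w\in F$ by zeros only, and $\mathbb B_n$ is the set of vertices obtained by continuing a vertex $w\in F$ by zeros followed by one non-zero last letter. (ii) There is a constant $C$, depending only on $\bar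 m$, on $\mathcal A$ and $\mathcal B$, and on $S$, such that for every symmetric probability measure $\mu$ with support contained in $S$ (in particular with $S=\operatorname{supp}\mu$), every $n$, every pair $(\mathbb A_n,\mathbb B_n)$ admissible at level $n$, and every $k\ge0$, $$H(\mu^{*k})\le C\Bigl(V_n+\frac{k}{R_n}\Bigr),\qquad R_n=\operatorname{Res}_{\Gamma_n}(\mathbb A_n,\mathbb B_n),$$ where $H(\nu)=-\sum_{\nu(g)>0}\nu(g)\log\nu(g)$ is the entropy and $\mu^{*k}$ the $k$-fold convolution power. -/

import Mathlib

open scoped ENNReal NNReal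

namespace SphericalTree

/-! Spherically homogeneous rooted trees, their automorphisms and sections.

A vertex of level `k` has `m k` children, i.e. `m k` is the valency usually written `m_{k+1}`.
A vertex of level `n` is a word of `n` letters; the letter of index `i` is the one chosen at the
`(i+1)`-st step away from the root. -/

/-- The vertices of level `n`. -/
abbrev Level (m : ℕ → ℕ) (n : ℕ) : Type := (i : Fin n) → Fin (m i)

/-- The parent of a vertex of level `n + 1`. -/
def parent {m : ℕ → ℕ} {n : ℕ} (v : Level m (n + 1)) : Level m n := fun i => v i.castSucc

/-- The group of automorphisms of the tree that fix the root: families of permutations of the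
levels that are compatible with passing to the parent. It acts on the left. -/
def TreeAut (m : ℕ → ℕ) : Subgroup ((n : ℕ) → Equiv.Perm (Level m n)) where
  carrier := {g | ∀ (n : ℕ) (v : Level m (n + 1)), parent (g (n + 1) v) = g n (parent v)}
  mul_mem' := by
    intro g h hg hh n v
    simp only [Pi.mul_apply, Equiv.Perm.mul_apply]
    rw [hg, hh]
  one_mem' := by
    intro n v
    rfl
  inv_mem' := by
    intro g hg n v
    have h := hg n ((g (n + 1))⁻¹ v)
    have e : g (n + 1) ((g (n + 1))⁻¹ v) = v := (g (n + 1)).apply_symm_apply v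
    rw [e] at h
    simp only [Pi.inv_apply]
    rw [h]
    exact ((g n).symm_apply_apply _).symm

/-- The action of an automorphism on the vertices of level `n`. -/
def act {m : ℕ → ℕ} (g : TreeAut m) {n : ℕ} (v : Level m n) : Level m n := g.1 n v

/-- The sequence of valencies of the subtree above a vertex of level `n`. -/
abbrev shift (m : ℕ → ℕ) (n : ℕ) : ℕ → ℕ := fun i => m (n + i)

/-- The vertex `v` of the subtree above the vertex `w`, seen as a vertex of the whole tree. -/
def append {m : ℕ → ℕ} {n k : ℕ} (w : Level m n) (v : Level (shift m n) k) : Level m (n + k) :=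
  Fin.addCases (motive := fun i : Fin (n + k) => Fin (m i)) w v

/-- The first `n` letters of a word. -/
def takeWord {m : ℕ → ℕ} (n k : ℕ) (u : Level m (n + k)) : Level m n := fun i => u (i.castAdd k)

/-- All letters of a word but the first `n`. -/
def dropWord {m : ℕ → ℕ} (n k : ℕ) (u : Level m (n + k)) : Level (shift m n) k :=
  fun i => u (i.natAdd n)

theorem takeWord_append {m : ℕ → ℕ} {n k : ℕ} (w : Level m n) (v : Level (shift m n) k) :
    takeWord n k (append w v) = w := by
  funext i
  simp [takeWord, append]

theorem dropWord_append {m : ℕ → ℕ} {n k : ℕ} (w : Level m n) (v : Level (shift m n) k) :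
    dropWord n k (append w v) = v := by
  funext i
  simp [dropWord, append]

theorem append_take_drop {m : ℕ → ℕ} (n k : ℕ) (u : Level m (n + k)) :
    append (takeWord n k u) (dropWord n k u) = u := by
  funext i
  refine Fin.addCases (fun i => ?_) (fun i => ?_) i <;> simp [takeWord, dropWord, append]

theorem takeWord_act {m : ℕ → ℕ} (g : TreeAut m) (n k : ℕ) (u : Level m (n + k)) :
    takeWord n k (act g u) = act g (takeWord n k u) := by
  induction k with
  | zero => rfl
  | succ k ih =>
    have h : parent (act g u) = act g (parent (n := n + k) u) := g.2 (n + k) u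
    have h' := ih (parent (n := n + k) u)
    rw [← h] at h'
    exact h'

theorem append_act {m : ℕ → ℕ} (g : TreeAut m) {n k : ℕ} (w : Level m n)
    (v : Level (shift m n) k) :
    append (act g w) (dropWord n k (act g (append w v))) = act g (append w v) := by
  have h := takeWord_act g n k (append w v)
  rw [takeWord_append] at h
  rw [← h, append_take_drop]

theorem act_inv_act {m : ℕ → ℕ} (g : TreeAut m) {n : ℕ} (v : Level m n) :
    act g⁻¹ (act g v) = v := by
  simp [act]

theorem act_act_inv {m : ℕ → ℕ} (g : TreeAut m) {n : ℕ} (v : Level m n) :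
    act g (act g⁻¹ v) = v := by
  simp [act]

/-- The section `g|_w`: the automorphism of the subtree above `w` with
`g (w v) = (g w) (g|_w v)` for all `v` (see `act_append`). -/
def sect {m : ℕ → ℕ} (g : TreeAut m) {n : ℕ} (w : Level m n) : TreeAut (shift m n) :=
  ⟨fun k =>
    { toFun := fun v => dropWord n k (act g (append w v))
      invFun := fun v => dropWord n k (act g⁻¹ (append (act g w) v))
      left_inv := by
        intro v
        simp only
        rw [append_act, act_inv_act, dropWord_append]
      right_inv := by
        intro v
        simp only
        have h := append_act g⁻¹ (act g w) v
        rw [act_inv_act] at h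
        rw [h, act_act_inv, dropWord_append] },
   by
    intro k v
    have h : parent (n := n + k) (act g (append w v) : Level m (n + (k + 1)))
        = act g (append w (parent v) : Level m (n + k)) := by
      have h1 : parent (n := n + k) (append w v : Level m (n + (k + 1)))
          = (append w (parent v) : Level m (n + k)) := by
        funext i
        refine Fin.addCases (fun i => ?_) (fun i => ?_) i
        · exact (congrFun (takeWord_append (k := k + 1) w v) i).trans
            (congrFun (takeWord_append (k := k) w (parent v)) i).symm
        · exact (congrFun (dropWord_append (k := k + 1) w v) i.castSucc).trans
            (congrFun (dropWord_append (k := k) w (parent v)) i).symm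
      rw [← h1]
      exact g.2 (n + k) (append w v : Level m (n + (k + 1)))
    exact congrArg (fun u : Level m (n + k) => (dropWord n k u : Level (shift m n) k)) h⟩

theorem act_append {m : ℕ → ℕ} (g : TreeAut m) {n k : ℕ} (w : Level m n)
    (v : Level (shift m n) k) :
    act g (append w v) = append (act g w) (act (sect g w) v) :=
  (append_act g w v).symm

/-- The vertex `0⋯0` of level `n`, on the `0`-ray. -/
def zeroWord (m : ℕ → ℕ) [∀ i, NeZero (m i)] (n : ℕ) : Level m n := fun _ => 0

/-- The neighbours of the `0`-ray: vertices that are not on the ray, but whose parent is. -/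
def IsRayNeighbour {m : ℕ → ℕ} [∀ i, NeZero (m i)] : {n : ℕ} → Level m n → Prop
  | 0, _ => False
  | n + 1, v => parent v = zeroWord m n ∧ v ≠ zeroWord m (n + 1)

/-! Principal groups of directed automorphisms. -/

/-- Rooted automorphisms: they permute the vertices of the first level and have trivial sections
there. They form the copy of the symmetric group on `m 0` letters in the automorphism group. -/
def IsRooted {m : ℕ → ℕ} (g : TreeAut m) : Prop := ∀ w : Level m 1, sect g w = 1

/-- Directed automorphisms: they fix the `0`-ray and their sections are trivial at all vertices
that are neither on the `0`-ray nor neighbours of it. -/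
def IsDirected {m : ℕ → ℕ} [∀ i, NeZero (m i)] (g : TreeAut m) : Prop :=
  (∀ n, act g (zeroWord m n) = zeroWord m n) ∧
    ∀ (n : ℕ) (v : Level m n), v ≠ zeroWord m n → ¬ IsRayNeighbour v → sect g v = 1

/-- The principal group of directed automorphisms generated by `𝒜` and `ℬ`. -/
def principalGroup {m : ℕ → ℕ} (𝒜 ℬ : Subgroup (TreeAut m)) : Subgroup (TreeAut m) := 𝒜 ⊔ ℬ

/-- The group `𝒜_n`, generated by the sections of elements of `𝒜` at the vertex of level `n` of
the `0`-ray. -/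
def raySections {m : ℕ → ℕ} [∀ i, NeZero (m i)] (𝒜 : Subgroup (TreeAut m)) (n : ℕ) :
    Subgroup (TreeAut (shift m n)) :=
  Subgroup.closure {h | ∃ a ∈ 𝒜, h = sect a (zeroWord m n)}

/-- The group `ℬ_n`. For `n ≥ 1` it is generated by the sections of elements of `𝒜` at the
neighbours of the `0`-ray of level `n` (the sections of elements of `ℬ` being trivial there);
for `n = 0` it is `ℬ` itself. -/
def neighbourSections {m : ℕ → ℕ} [∀ i, NeZero (m i)] (𝒜 ℬ : Subgroup (TreeAut m)) (n : ℕ) :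
    Subgroup (TreeAut (shift m n)) :=
  Subgroup.closure
    ({h | ∃ a ∈ 𝒜, ∃ v : Level m n, IsRayNeighbour v ∧ h = sect a v} ∪
      {h | ∃ b ∈ ℬ, ∃ v : Level m n, h = sect b v})

/-- `A` and `B` are disjoint sets of vertices of level `n` such that every `s ∈ S` has its section
at `w` in `𝒜_n` if `w ∈ A`, in `ℬ_n` if `w ∈ B`, and trivial otherwise. -/
structure IsSectionPartition {m : ℕ → ℕ} [∀ i, NeZero (m i)] (𝒜 ℬ : Subgroup (TreeAut m))
    (S : Finset (TreeAut m)) (n : ℕ) (A B : Set (Level m n)) : Prop where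
  disjoint : Disjoint A B
  sect_mem_ray : ∀ s ∈ S, ∀ w ∈ A, sect s w ∈ raySections 𝒜 n
  sect_mem_neighbour : ∀ s ∈ S, ∀ w ∈ B, sect s w ∈ neighbourSections 𝒜 ℬ n
  sect_eq_one : ∀ s ∈ S, ∀ w, w ∉ A → w ∉ B → sect s w = 1

/-! Schreier graphs and effective resistance. -/

open Classical in
/-- The conductance between two vertices of the Schreier graph of the action on level `n` of the
group generated by the finite symmetric set `S`: the number of edges (labelled by elements of `S`,
all of conductance `1`) that join them. -/
noncomputable def schreierConductance {m : ℕ → ℕ} (S : Finset (TreeAut m)) (n : ℕ)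
    (v w : Level m n) : ℝ :=
  ((S.filter (fun s => act s v = w)).card : ℝ)

/-- The Dirichlet energy of a function on a finite network with symmetric conductances `c`. -/
noncomputable def dirichletEnergy {V : Type*} [Fintype V] (c : V → V → ℝ) (f : V → ℝ) : ℝ :=
  (1 / 2) * ∑ v, ∑ w, c v w * (f v - f w) ^ 2

/-- The effective conductance between two disjoint sets of vertices of a finite, possibly
disconnected network: the least energy of a function that is `1` on `A` and `0` on `B`. -/
noncomputable def effectiveConductance {V : Type*} [Fintype V] (c : V → V → ℝ) (A B : Set V) :
    ℝ≥0∞ :=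
  ⨅ (f : V → ℝ) (_ : (∀ v ∈ A, f v = 1) ∧ ∀ v ∈ B, f v = 0), ENNReal.ofReal (dirichletEnergy c f)

/-- The effective resistance between two sets; it is `∞` if no path joins them. -/
noncomputable def effectiveResistance {V : Type*} [Fintype V] (c : V → V → ℝ) (A B : Set V) :
    ℝ≥0∞ :=
  (effectiveConductance c A B)⁻¹

/-- The number of vertices of level `n`. -/
def levelSize (m : ℕ → ℕ) (n : ℕ) : ℕ := ∏ i ∈ Finset.range n, m i

/-! Convolution powers and entropy. -/

/-- The `k`-fold convolution power of a probability measure: the law of a product of `k`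
independent elements with law `μ`. -/
noncomputable def convPow {G : Type*} [Group G] (μ : PMF G) : ℕ → PMF G
  | 0 => PMF.pure 1
  | k + 1 => (convPow μ k).bind fun g => μ.map fun s => g * s

/-- The entropy `-∑ ν(e) log ν(e)`, with values in `[0, ∞]`. -/
noncomputable def entropy {E : Type*} (ν : PMF E) : ℝ≥0∞ :=
  ∑' e, ENNReal.ofReal (Real.negMulLog (ν e).toReal)

end SphericalTree

open SphericalTree

/-!
The first part rests on the shape of directed automorphisms: such an automorphism has a section
that need not be rooted at one vertex of each level only, the one on the `0`-ray. In a product of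
generators, the sections at a vertex multiply along its orbit, so that they can be non-trivial only
at the vertices of finitely many rays, the preimages of the `0`-ray under suffixes of the product,
and at the neighbours of these rays (`exists_sectionsAlong`). All these rays are eventually `0`,
because rooted automorphisms change only the first letter of a ray and directed ones change finitely
many. A level below which all of these rays are `0` separates them, and serves as `n₀`.

For the second part, an automorphism is determined by its action on level `n` and its sections there
(`eq_of_act_eq_of_sect_eq`). There are at most exponentially many actions in the size of the level
(`ncard_levelActions_le`). The section of a random product at `v` is an alternating product of
elements of the groups `𝒜_n` and `ℬ_n`, which are finite of sizes bounded independently of `n`; the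
number of its factors is governed by how often the random walk on level `n` that starts at `v` goes
from `B` back to `A`. As there are exponentially many alternating products of a given length, Gibbs'
inequality bounds the entropy by a multiple of the size of the level plus the expected number of
such passages, summed over all `v` (`entropy_le_altLength`).

It remains to count passages. Let `φ` be the probability that the walk reaches `A` before `B`, a
function that is harmonic off `A ∪ B`. Charging, at each visit to `B`, the probability that the next
of the two sets to be visited is `A` gives an upper bound (`tsum_convPow_altLength_le`). Since the
counting measure is stationary, the total charge in one step is the flow of `φ` into `B`
(`sum_altBound`). This flow is the energy of `φ`, which is the least one for its boundary values
(`sum_indicator_le_energy`); as the weights of the walk are at most `1`, it is at most the effective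
conductance of the Schreier graph (`exists_harmonic_flow_le`).
-/

open scoped ENNReal NNReal

namespace SphericalTree

section

variable {m : ℕ → ℕ}

/-! ### Automorphisms, their sections and their action on rays -/

theorem act_mul (g h : TreeAut m) {n : ℕ} (v : Level m n) : act (g * h) v = act g (act h v) := rfl

theorem act_one {n : ℕ} (v : Level m n) : act (1 : TreeAut m) v = v := rfl

theorem parent_act (g : TreeAut m) {n : ℕ} (v : Level m (n + 1)) :
    parent (act g v) = act g (parent v) := g.2 n v

theorem treeAut_ext {g h : TreeAut m} (H : ∀ (n : ℕ) (v : Level m n), act g v = act h v) :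
    g = h :=
  Subtype.ext (funext fun n => Equiv.ext (H n))

theorem act_sect (g : TreeAut m) {n k : ℕ} (w : Level m n) (v : Level (shift m n) k) :
    act (sect g w) v = dropWord n k (act g (append w v)) := rfl

theorem sect_mul (g h : TreeAut m) {n : ℕ} (w : Level m n) :
    sect (g * h) w = sect g (act h w) * sect h w :=
  treeAut_ext fun k v => by
    rw [act_mul, act_sect, act_mul, act_append h, act_append g, dropWord_append]

theorem sect_one {n : ℕ} (w : Level m n) : sect (1 : TreeAut m) w = 1 :=
  treeAut_ext fun k v => by rw [act_sect, act_one, dropWord_append, act_one]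

/-- An automorphism is determined by its action on one level and its sections there. -/
theorem eq_of_act_eq_of_sect_eq [∀ i, NeZero (m i)] {g h : TreeAut m} (n : ℕ)
    (hact : ∀ v : Level m n, act g v = act h v)
    (hsect : ∀ w : Level m n, sect g w = sect h w) : g = h := by
  refine treeAut_ext fun k v => ?_
  rcases le_total n k with hk | hk
  · obtain ⟨j, rfl⟩ := Nat.exists_eq_add_of_le hk
    rw [← append_take_drop n j v, act_append, act_append, hact, hsect]
  · obtain ⟨j, rfl⟩ := Nat.exists_eq_add_of_le hk
    have h1 := takeWord_act g k j (append v (zeroWord (shift m k) j))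
    have h2 := takeWord_act h k j (append v (zeroWord (shift m k) j))
    rw [takeWord_append] at h1 h2
    rw [← h1, ← h2, hact]

/-- A point of the boundary of the tree, as an infinite word. -/
abbrev Ray (m : ℕ → ℕ) : Type := (i : ℕ) → Fin (m i)

/-- The vertex of level `n` on a ray. -/
def truncRay (ξ : Ray m) (n : ℕ) : Level m n := fun i => ξ i

/-- The action on the boundary. -/
def actRay (g : TreeAut m) (ξ : Ray m) : Ray m := fun i => act g (truncRay ξ (i + 1)) (Fin.last i)

theorem truncRay_actRay (g : TreeAut m) (ξ : Ray m) (n : ℕ) :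
    truncRay (actRay g ξ) n = act g (truncRay ξ n) := by
  induction n with
  | zero => funext i; exact i.elim0
  | succ n ih =>
    funext i
    refine Fin.lastCases ?_ (fun i => ?_) i
    · rfl
    · have h : parent (act g (truncRay ξ (n + 1))) = act g (truncRay ξ n) := parent_act g _
      rw [← ih] at h
      exact (congrFun h i).symm

theorem ray_ext {ξ η : Ray m} (h : ∀ n, truncRay ξ n = truncRay η n) : ξ = η :=
  funext fun i => congrFun (h (i + 1)) (Fin.last i)

theorem actRay_mul (g h : TreeAut m) (ξ : Ray m) :
    actRay (g * h) ξ = actRay g (actRay h ξ) :=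
  ray_ext fun n => by simp only [truncRay_actRay, act_mul]

/-- The ray from the vertex on `ξ` of level `n`, in the subtree above this vertex. -/
def tailRay (n : ℕ) (ξ : Ray m) : Ray (shift m n) := fun i => ξ (n + i)

theorem append_truncRay (ξ : Ray m) (n k : ℕ) :
    append (truncRay ξ n) (truncRay (tailRay n ξ) k) = truncRay ξ (n + k) :=
  append_take_drop n k (truncRay ξ (n + k))

theorem actRay_sect (g : TreeAut m) (ξ : Ray m) (n : ℕ) :
    actRay (sect g (truncRay ξ n)) (tailRay n ξ) = tailRay n (actRay g ξ) := by
  funext i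
  have h : truncRay (actRay (sect g (truncRay ξ n)) (tailRay n ξ)) (i + 1)
      = truncRay (tailRay n (actRay g ξ)) (i + 1) := by
    rw [truncRay_actRay, act_sect, append_truncRay, ← truncRay_actRay]
    rfl
  exact congrFun h (Fin.last i)

theorem exists_ray (n : ℕ) (w : Level m n) (ζ : Ray (shift m n)) :
    ∃ ξ : Ray m, truncRay ξ n = w ∧ tailRay n ξ = ζ := by
  refine ⟨fun i => append w (truncRay ζ (i + 1)) ⟨i, by omega⟩, ?_, ?_⟩
  · funext i
    exact congrFun (takeWord_append w (truncRay ζ (i + 1))) i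
  · funext i
    exact congrFun (dropWord_append w (truncRay ζ (n + i + 1))) ⟨i, by omega⟩

theorem eq_one_iff_actRay [∀ i, NeZero (m i)] (g : TreeAut m) :
    g = 1 ↔ ∀ ξ, actRay g ξ = ξ := by
  constructor
  · rintro rfl ξ
    exact ray_ext fun n => by rw [truncRay_actRay, act_one]
  · intro h
    refine treeAut_ext fun n v => ?_
    obtain ⟨ξ, rfl, -⟩ := exists_ray n v (fun _ => 0)
    rw [← truncRay_actRay, h, act_one]

theorem sect_eq_one_iff [∀ i, NeZero (m i)] (g : TreeAut m) {n : ℕ} (w : Level m n) :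
    sect g w = 1 ↔ ∀ ξ : Ray m, truncRay ξ n = w → tailRay n (actRay g ξ) = tailRay n ξ := by
  rw [eq_one_iff_actRay]
  constructor
  · rintro h ξ rfl
    rw [← actRay_sect, h]
  · intro h ζ
    obtain ⟨ξ, rfl, rfl⟩ := exists_ray n w ζ
    rw [actRay_sect, h ξ rfl]

/-- Sections at vertices above a vertex with trivial section are trivial. -/
theorem sect_truncRay_eq_one_of_le [∀ i, NeZero (m i)] (g : TreeAut m) {n k : ℕ} (hnk : n ≤ k)
    (ξ : Ray m) (h : sect g (truncRay ξ n) = 1) : sect g (truncRay ξ k) = 1 := by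
  rw [sect_eq_one_iff] at h ⊢
  intro η hη
  have h1 : truncRay η n = truncRay ξ n := by
    funext i
    exact congrFun hη (i.castLE hnk)
  have h2 := h η h1
  obtain ⟨j, rfl⟩ := Nat.exists_eq_add_of_le hnk
  funext i
  have h3 : ∀ i, actRay g η (n + i) = η (n + i) := fun i => congrFun h2 i
  show actRay g η (n + j + i) = η (n + j + i)
  rw [Nat.add_assoc]
  exact h3 (j + i)

/-- The vertex `w` is a neighbour of the ray `ξ`: it is not on `ξ`, but its parent is. -/
def IsNeighbourOf (ξ : Ray m) : {n : ℕ} → Level m n → Prop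
  | 0, _ => False
  | n + 1, w => parent w = truncRay ξ n ∧ w ≠ truncRay ξ (n + 1)

theorem act_eq_truncRay_iff (h : TreeAut m) (ξ : Ray m) {n : ℕ} (w : Level m n) :
    act h w = truncRay ξ n ↔ w = truncRay (actRay h⁻¹ ξ) n := by
  rw [truncRay_actRay]
  constructor
  · intro e
    rw [← e, act_inv_act]
  · rintro rfl
    rw [act_act_inv]

theorem isNeighbourOf_act_iff (h : TreeAut m) (ξ : Ray m) {n : ℕ} (w : Level m n) :
    IsNeighbourOf ξ (act h w) ↔ IsNeighbourOf (actRay h⁻¹ ξ) w := by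
  cases n with
  | zero => exact Iff.rfl
  | succ n =>
    simp only [IsNeighbourOf, parent_act, act_eq_truncRay_iff, ne_eq]

variable [∀ i, NeZero (m i)]

theorem IsRooted.sect_eq_one {g : TreeAut m} (hg : IsRooted g) {n : ℕ} (w : Level m (n + 1)) :
    sect g w = 1 := by
  obtain ⟨ξ, rfl, -⟩ := exists_ray (n + 1) w (fun _ => 0)
  exact sect_truncRay_eq_one_of_le g (Nat.le_add_left 1 n) ξ (hg _)

/-- The section of a directed automorphism at a neighbour of the `0`-ray is rooted. -/
theorem IsDirected.isRooted_sect {a : TreeAut m} (ha : IsDirected a) {n : ℕ} {v : Level m n}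
    (hv : IsRayNeighbour v) : IsRooted (sect a v) := by
  have hv0 : v ≠ zeroWord m n := by
    cases n with
    | zero => exact hv.elim
    | succ n => exact hv.2
  intro w
  rw [sect_eq_one_iff]
  intro ζ _
  obtain ⟨ξ, rfl, rfl⟩ := exists_ray n v ζ
  have h1 : sect a (truncRay ξ (n + 1)) = 1 := by
    refine ha.2 _ _ (fun h => hv0 ?_) (fun h => hv0 h.1)
    exact congrArg parent h
  rw [sect_eq_one_iff] at h1
  have h2 := h1 ξ rfl
  rw [actRay_sect]
  funext i
  have h3 : ∀ i, actRay a ξ (n + 1 + i) = ξ (n + 1 + i) := fun i => congrFun h2 i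
  show actRay a ξ (n + (1 + i)) = ξ (n + (1 + i))
  rw [← Nat.add_assoc]
  exact h3 i

theorem IsRooted.isRooted_sect {b : TreeAut m} (hb : IsRooted b) {n : ℕ} (v : Level m n) :
    IsRooted (sect b v) := by
  intro w
  rw [sect_eq_one_iff]
  intro ζ _
  obtain ⟨ξ, rfl, rfl⟩ := exists_ray n v ζ
  have h1 := hb.sect_eq_one (truncRay ξ (n + 1))
  rw [sect_eq_one_iff] at h1
  have h2 := h1 ξ rfl
  rw [actRay_sect]
  funext i
  have h3 : ∀ i, actRay b ξ (n + 1 + i) = ξ (n + 1 + i) := fun i => congrFun h2 i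
  show actRay b ξ (n + (1 + i)) = ξ (n + (1 + i))
  rw [← Nat.add_assoc]
  exact h3 i

end

section

variable {m : ℕ → ℕ}

/-! ### The sizes of the groups involved -/

/-- The actions of automorphisms on the vertices of level `n`. -/
def levelActions (m : ℕ → ℕ) (n : ℕ) : Set (Level m n → Level m n) :=
  Set.range fun (g : TreeAut m) (v : Level m n) => act g v

theorem card_level (m : ℕ → ℕ) (n : ℕ) : Fintype.card (Level m n) = levelSize m n := by
  simp [levelSize, Finset.prod_range]

/-- The child of `v` with last letter `x`. -/
def child {n : ℕ} (v : Level m n) (x : Fin (m n)) : Level m (n + 1) :=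
  Fin.snoc (α := fun i : Fin (n + 1) => Fin (m i)) v x

theorem parent_child {n : ℕ} (v : Level m n) (x : Fin (m n)) : parent (child v x) = v := by
  funext i
  simp [parent, child]

theorem child_parent {n : ℕ} (v : Level m (n + 1)) : child (parent v) (v (Fin.last n)) = v :=
  Fin.snoc_init_self (α := fun i : Fin (n + 1) => Fin (m i)) v

variable [∀ i, NeZero (m i)]

theorem ncard_levelActions_succ_le (n : ℕ) :
    (levelActions m (n + 1)).ncard
      ≤ (levelActions m n).ncard * (m n ^ m n) ^ levelSize m n := by
  let X := levelActions m n ×ˢ (Set.univ : Set (Level m n → Fin (m n) → Fin (m n)))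
  have hX : X.ncard = (levelActions m n).ncard * (m n ^ m n) ^ levelSize m n := by
    rw [Set.ncard_prod, Set.ncard_univ, Nat.card_eq_fintype_card, ← card_level]
    simp
  rw [← hX]
  -- The action on level `n + 1` is recorded by the action on level `n` and the last letters.
  let Φ : (Level m (n + 1) → Level m (n + 1)) →
      (Level m n → Level m n) × (Level m n → Fin (m n) → Fin (m n)) := fun f =>
    (fun v => parent (f (child v 0)), fun v x => f (child v x) (Fin.last n))
  refine Set.ncard_le_ncard_of_injOn Φ ?_ ?_ (Set.toFinite _)
  · rintro _ ⟨g, rfl⟩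
    refine ⟨⟨g, ?_⟩, trivial⟩
    funext v
    simp only [Φ, parent_act, parent_child]
  · rintro _ ⟨g, rfl⟩ _ ⟨h, rfl⟩ hgh
    funext v
    have h1 := congrFun (congrArg Prod.fst hgh) (parent v)
    have h2 := congrFun (congrFun (congrArg Prod.snd hgh) (parent v)) (v (Fin.last n))
    simp only [Φ, parent_act, parent_child, child_parent] at h1 h2
    show act g v = act h v
    rw [← child_parent (act g v), ← child_parent (act h v), parent_act, parent_act, h1, h2]

theorem pow_self_le {M : ℕ} (hM : ∀ i, m i ≤ M) (i : ℕ) : m i ^ m i ≤ M ^ M :=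
  (Nat.pow_le_pow_left (hM i) _).trans
    (Nat.pow_le_pow_right ((Nat.pos_of_neZero (m i)).trans_le (hM i)) (hM i))

theorem ncard_levelActions_le {M : ℕ} (hM : ∀ i, m i ≤ M) (n : ℕ) :
    (levelActions m n).ncard ≤ (M ^ M) ^ levelSize m n := by
  have hpos : 0 < M ^ M := (Nat.pow_pos (Nat.pos_of_neZero (m 0))).trans_le (pow_self_le hM 0)
  induction n with
  | zero =>
    have h : (levelActions m 0).ncard ≤ 1 :=
      Set.ncard_le_one_of_subsingleton _
    exact h.trans (Nat.pow_pos hpos)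
  | succ n ih =>
    refine (ncard_levelActions_succ_le n).trans ?_
    have hV : levelSize m (n + 1) = levelSize m n * m n := Finset.prod_range_succ _ _
    -- A level with valency `1` contributes nothing, any other one at least doubles the size.
    rcases Nat.lt_or_ge (m n) 2 with h | h
    · have h1 : m n = 1 := by have := Nat.pos_of_neZero (m n); omega
      rw [hV, h1]
      simpa using ih
    · calc (levelActions m n).ncard * (m n ^ m n) ^ levelSize m n
          ≤ (M ^ M) ^ levelSize m n * (M ^ M) ^ levelSize m n :=
            Nat.mul_le_mul ih (Nat.pow_le_pow_left (pow_self_le hM n) _)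
        _ = (M ^ M) ^ (levelSize m n * 2) := by rw [← pow_add, mul_two]
        _ ≤ (M ^ M) ^ levelSize m (n + 1) := by
            rw [hV]
            exact Nat.pow_le_pow_right hpos (Nat.mul_le_mul_left _ h)

/-- The group of rooted automorphisms. -/
def rootedSubgroup (m : ℕ → ℕ) : Subgroup (TreeAut m) where
  carrier := {g | IsRooted g}
  mul_mem' := by
    intro g h hg hh w
    rw [sect_mul, hg, hh, one_mul]
  one_mem' := sect_one
  inv_mem' := by
    intro g hg w
    have h := sect_mul g g⁻¹ w
    rwa [mul_inv_cancel, sect_one, hg, one_mul, eq_comm] at h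

theorem finite_rootedSubgroup_and_card_le :
    Finite (rootedSubgroup m) ∧ Nat.card (rootedSubgroup m) ≤ m 0 ^ m 0 := by
  let Φ : rootedSubgroup m → levelActions m 1 := fun g => ⟨fun v => act g.1 v, g.1, rfl⟩
  have hΦ : Function.Injective Φ := by
    intro g h hgh
    refine Subtype.ext (eq_of_act_eq_of_sect_eq 1 (fun v => ?_) fun w => ?_)
    · exact congrFun (congrArg Subtype.val hgh) v
    · rw [g.2 w, h.2 w]
  refine ⟨Finite.of_injective Φ hΦ, (Nat.card_le_card_of_injective Φ hΦ).trans ?_⟩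
  have h0 : (levelActions m 0).ncard ≤ 1 := Set.ncard_le_one_of_subsingleton _
  calc Nat.card (levelActions m 1) = (levelActions m (0 + 1)).ncard := rfl
    _ ≤ (levelActions m 0).ncard * (m 0 ^ m 0) ^ levelSize m 0 := ncard_levelActions_succ_le 0
    _ ≤ 1 * (m 0 ^ m 0) ^ levelSize m 0 := Nat.mul_le_mul_right _ h0
    _ = m 0 ^ m 0 := by simp [levelSize]

theorem neighbourSections_le_rootedSubgroup {𝒜 ℬ : Subgroup (TreeAut m)}
    (h𝒜 : ∀ a ∈ 𝒜, IsDirected a) (hℬ : ∀ b ∈ ℬ, IsRooted b) (n : ℕ) :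
    neighbourSections 𝒜 ℬ n ≤ rootedSubgroup (shift m n) := by
  refine (Subgroup.closure_le _).2 ?_
  rintro h (⟨a, ha, v, hv, rfl⟩ | ⟨b, hb, v, rfl⟩)
  · exact (h𝒜 a ha).isRooted_sect hv
  · exact (hℬ b hb).isRooted_sect v

theorem finite_neighbourSections_and_card_le {𝒜 ℬ : Subgroup (TreeAut m)}
    (h𝒜 : ∀ a ∈ 𝒜, IsDirected a) (hℬ : ∀ b ∈ ℬ, IsRooted b) {M : ℕ} (hM : ∀ i, m i ≤ M) (n : ℕ) :
    Finite (neighbourSections 𝒜 ℬ n) ∧ Nat.card (neighbourSections 𝒜 ℬ n) ≤ M ^ M := by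
  obtain ⟨hfin, hcard⟩ := finite_rootedSubgroup_and_card_le (m := shift m n)
  have hle := neighbourSections_le_rootedSubgroup h𝒜 hℬ n
  have hinj := Subgroup.inclusion_injective hle
  exact ⟨Finite.of_injective _ hinj,
    (Nat.card_le_card_of_injective _ hinj).trans (hcard.trans (pow_self_le hM n))⟩

/-- Taking the section at a vertex of the `0`-ray, as a homomorphism on a group of directed
automorphisms. -/
def raySectionHom (𝒜 : Subgroup (TreeAut m)) (h𝒜 : ∀ a ∈ 𝒜, IsDirected a) (n : ℕ) :
    𝒜 →* TreeAut (shift m n) where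
  toFun a := sect a.1 (zeroWord m n)
  map_one' := sect_one _
  map_mul' a b := by
    rw [Subgroup.coe_mul, sect_mul, (h𝒜 b.1 b.2).1 n]

theorem finite_raySections_and_card_le {𝒜 : Subgroup (TreeAut m)} [Finite 𝒜]
    (h𝒜 : ∀ a ∈ 𝒜, IsDirected a) (n : ℕ) :
    Finite (raySections 𝒜 n) ∧ Nat.card (raySections 𝒜 n) ≤ Nat.card 𝒜 := by
  have hle : raySections 𝒜 n ≤ (raySectionHom 𝒜 h𝒜 n).range := by
    refine (Subgroup.closure_le _).2 ?_
    rintro _ ⟨a, ha, rfl⟩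
    exact ⟨⟨a, ha⟩, rfl⟩
  have hinj := Subgroup.inclusion_injective hle
  have hfin := Finite.of_surjective _ (raySectionHom 𝒜 h𝒜 n).rangeRestrict_surjective
  exact ⟨Finite.of_injective _ hinj, (Nat.card_le_card_of_injective _ hinj).trans
    (Nat.card_le_card_of_surjective _ (raySectionHom 𝒜 h𝒜 n).rangeRestrict_surjective)⟩

/-! ### Sections of elements of a principal group at deep levels -/

/-- At all levels but the first, the sections of `g` are in `𝒜_n` away from the neighbours of the
rays in `E`, and in `ℬ_n` away from the rays in `E` themselves, and so trivial away from both. -/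
structure SectionsAlong (𝒜 ℬ : Subgroup (TreeAut m)) (g : TreeAut m) (E : Set (Ray m)) :
    Prop where
  mem_ray : ∀ (n : ℕ) (w : Level m (n + 1)), (∀ ξ ∈ E, ¬ IsNeighbourOf ξ w) →
    sect g w ∈ raySections 𝒜 (n + 1)
  mem_neighbour : ∀ (n : ℕ) (w : Level m (n + 1)), (∀ ξ ∈ E, w ≠ truncRay ξ (n + 1)) →
    sect g w ∈ neighbourSections 𝒜 ℬ (n + 1)
  eq_one : ∀ (n : ℕ) (w : Level m (n + 1)), (∀ ξ ∈ E, ¬ IsNeighbourOf ξ w) →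
    (∀ ξ ∈ E, w ≠ truncRay ξ (n + 1)) → sect g w = 1

theorem SectionsAlong.mono {𝒜 ℬ : Subgroup (TreeAut m)} {g : TreeAut m} {E E' : Set (Ray m)}
    (h : SectionsAlong 𝒜 ℬ g E) (hE : E ⊆ E') : SectionsAlong 𝒜 ℬ g E' where
  mem_ray n w hw := h.mem_ray n w fun ξ hξ => hw ξ (hE hξ)
  mem_neighbour n w hw := h.mem_neighbour n w fun ξ hξ => hw ξ (hE hξ)
  eq_one n w hw hw' := h.eq_one n w (fun ξ hξ => hw ξ (hE hξ)) fun ξ hξ => hw' ξ (hE hξ)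

theorem SectionsAlong.mul {𝒜 ℬ : Subgroup (TreeAut m)} {g h : TreeAut m} {E E' : Set (Ray m)}
    (hg : SectionsAlong 𝒜 ℬ g E) (hh : SectionsAlong 𝒜 ℬ h E') :
    SectionsAlong 𝒜 ℬ (g * h) (E' ∪ actRay h⁻¹ '' E) := by
  have hray : ∀ (n : ℕ) (w : Level m (n + 1)),
      (∀ ξ ∈ E' ∪ actRay h⁻¹ '' E, w ≠ truncRay ξ (n + 1)) →
      ∀ ξ ∈ E, act h w ≠ truncRay ξ (n + 1) := fun n w hw ξ hξ => by
    rw [ne_eq, act_eq_truncRay_iff]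
    exact hw _ (Or.inr ⟨ξ, hξ, rfl⟩)
  have hnb : ∀ (n : ℕ) (w : Level m (n + 1)),
      (∀ ξ ∈ E' ∪ actRay h⁻¹ '' E, ¬ IsNeighbourOf ξ w) →
      ∀ ξ ∈ E, ¬ IsNeighbourOf ξ (act h w) := fun n w hw ξ hξ => by
    rw [isNeighbourOf_act_iff]
    exact hw _ (Or.inr ⟨ξ, hξ, rfl⟩)
  refine ⟨fun n w hw => ?_, fun n w hw => ?_, fun n w hw hw' => ?_⟩
  · rw [sect_mul]
    exact mul_mem (hg.mem_ray n _ (hnb n w hw))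
      (hh.mem_ray n w fun ξ hξ => hw ξ (Or.inl hξ))
  · rw [sect_mul]
    exact mul_mem (hg.mem_neighbour n _ (hray n w hw))
      (hh.mem_neighbour n w fun ξ hξ => hw ξ (Or.inl hξ))
  · rw [sect_mul, hg.eq_one n _ (hnb n w hw) (hray n w hw'),
      hh.eq_one n w (fun ξ hξ => hw ξ (Or.inl hξ)) fun ξ hξ => hw' ξ (Or.inl hξ), one_mul]

/-- The `0`-ray. -/
def zeroRay (m : ℕ → ℕ) [∀ i, NeZero (m i)] : Ray m := fun _ => 0

theorem isNeighbourOf_zeroRay_iff {n : ℕ} (w : Level m n) :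
    IsNeighbourOf (zeroRay m) w ↔ IsRayNeighbour w := by
  cases n <;> exact Iff.rfl

theorem IsDirected.sectionsAlong {𝒜 ℬ : Subgroup (TreeAut m)} {a : TreeAut m} (ha : a ∈ 𝒜)
    (hd : IsDirected a) : SectionsAlong 𝒜 ℬ a {zeroRay m} := by
  refine ⟨fun n w hw => ?_, fun n w hw => ?_, fun n w hw hw' => ?_⟩
  · have h1 : ¬ IsRayNeighbour w := by
      rw [← isNeighbourOf_zeroRay_iff]
      exact hw _ rfl
    by_cases h : w = zeroWord m (n + 1)
    · exact Subgroup.subset_closure ⟨a, ha, by rw [h]⟩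
    · rw [hd.2 _ w h h1]
      exact one_mem _
  · have h1 : w ≠ zeroWord m (n + 1) := hw _ rfl
    by_cases h : IsRayNeighbour w
    · exact Subgroup.subset_closure (Or.inl ⟨a, ha, w, h, rfl⟩)
    · rw [hd.2 _ w h1 h]
      exact one_mem _
  · refine hd.2 _ w (hw' _ rfl) ?_
    rw [← isNeighbourOf_zeroRay_iff]
    exact hw _ rfl

theorem IsRooted.sectionsAlong {𝒜 ℬ : Subgroup (TreeAut m)} {b : TreeAut m} (hb : IsRooted b) :
    SectionsAlong 𝒜 ℬ b ∅ :=
  ⟨fun _ w _ => by rw [hb.sect_eq_one w]; exact one_mem _,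
    fun _ w _ => by rw [hb.sect_eq_one w]; exact one_mem _, fun _ w _ _ => hb.sect_eq_one w⟩

/-- All but finitely many letters of the ray are `0`. -/
def EventuallyZero (ξ : Ray m) : Prop := ∀ᶠ i in Filter.atTop, ξ i = 0

theorem EventuallyZero.actRay_of_sect_eq_one {g : TreeAut m} {ξ : Ray m} (hξ : EventuallyZero ξ)
    {n : ℕ} (h : sect g (truncRay ξ n) = 1) : EventuallyZero (actRay g ξ) := by
  rw [sect_eq_one_iff] at h
  have h1 : ∀ i, actRay g ξ (n + i) = ξ (n + i) := fun i => congrFun (h ξ rfl) i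
  filter_upwards [hξ, Filter.eventually_ge_atTop n] with i hi hn
  obtain ⟨j, rfl⟩ := Nat.exists_eq_add_of_le hn
  rw [h1, hi]

theorem IsRooted.eventuallyZero {b : TreeAut m} (hb : IsRooted b) {ξ : Ray m}
    (hξ : EventuallyZero ξ) : EventuallyZero (actRay b ξ) :=
  hξ.actRay_of_sect_eq_one (hb (truncRay ξ 1))

/-- A directed automorphism fixes the `0`-ray, and changes finitely many letters of any other ray:
its section is trivial as soon as the ray has left the `0`-ray and its neighbours. -/
theorem IsDirected.eventuallyZero {a : TreeAut m} (ha : IsDirected a) {ξ : Ray m}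
    (hξ : EventuallyZero ξ) : EventuallyZero (actRay a ξ) := by
  by_cases h : ∀ n, truncRay ξ n = zeroWord m n
  · have h1 : actRay a ξ = ξ := ray_ext fun n => by rw [truncRay_actRay, h, ha.1]
    rwa [h1]
  · push Not at h
    obtain ⟨n, hn⟩ := h
    exact hξ.actRay_of_sect_eq_one
      (ha.2 (n + 1) (truncRay ξ (n + 1)) (fun h => hn (congrArg parent h)) fun h => hn h.1)

/-- Every element of the principal group has sections along finitely many rays, which are
eventually `0`: the images of the `0`-ray under the inverses of the suffixes of a word that
represents the element. That the inverse of the element preserves the rays that are eventually `0`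
is what makes the induction on the word work. -/
theorem exists_sectionsAlong {𝒜 ℬ : Subgroup (TreeAut m)} (h𝒜 : ∀ a ∈ 𝒜, IsDirected a)
    (hℬ : ∀ b ∈ ℬ, IsRooted b) {g : TreeAut m} (hg : g ∈ principalGroup 𝒜 ℬ) :
    (∃ E : Set (Ray m), E.Finite ∧ (∀ ξ ∈ E, EventuallyZero ξ) ∧ SectionsAlong 𝒜 ℬ g E) ∧
      ∀ ξ, EventuallyZero ξ → EventuallyZero (actRay g⁻¹ ξ) := by
  have hgen : ∀ x ∈ (𝒜 ∪ ℬ : Set (TreeAut m)),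
      (∃ E : Set (Ray m), E.Finite ∧ (∀ ξ ∈ E, EventuallyZero ξ) ∧ SectionsAlong 𝒜 ℬ x E) ∧
      ∀ ξ, EventuallyZero ξ → EventuallyZero (actRay x⁻¹ ξ) := by
    rintro x (hx | hx)
    · refine ⟨⟨{zeroRay m}, Set.finite_singleton _, ?_, (h𝒜 x hx).sectionsAlong hx⟩,
        fun ξ hξ => (h𝒜 _ (inv_mem hx)).eventuallyZero hξ⟩
      rintro _ rfl
      exact Filter.Eventually.of_forall fun _ => rfl
    · exact ⟨⟨∅, Set.finite_empty, fun _ h => h.elim, (hℬ x hx).sectionsAlong⟩,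
        fun ξ hξ => (hℬ _ (inv_mem hx)).eventuallyZero hξ⟩
  have hmul : ∀ x y : TreeAut m,
      ((∃ E : Set (Ray m), E.Finite ∧ (∀ ξ ∈ E, EventuallyZero ξ) ∧ SectionsAlong 𝒜 ℬ x E) ∧
        ∀ ξ, EventuallyZero ξ → EventuallyZero (actRay x⁻¹ ξ)) →
      ((∃ E : Set (Ray m), E.Finite ∧ (∀ ξ ∈ E, EventuallyZero ξ) ∧ SectionsAlong 𝒜 ℬ y E) ∧
        ∀ ξ, EventuallyZero ξ → EventuallyZero (actRay y⁻¹ ξ)) →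
      ((∃ E : Set (Ray m), E.Finite ∧ (∀ ξ ∈ E, EventuallyZero ξ) ∧
          SectionsAlong 𝒜 ℬ (x * y) E) ∧
        ∀ ξ, EventuallyZero ξ → EventuallyZero (actRay (x * y)⁻¹ ξ)) := by
    rintro x y ⟨⟨E, hE, hE0, hxE⟩, hx⟩ ⟨⟨E', hE', hE0', hyE⟩, hy⟩
    refine ⟨⟨_, hE'.union (hE.image _), ?_, hxE.mul hyE⟩, fun ξ hξ => ?_⟩
    · rintro ξ (hξ | ⟨η, hη, rfl⟩)
      · exact hE0' ξ hξ
      · exact hy η (hE0 η hη)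
    · rw [mul_inv_rev, actRay_mul]
      exact hy _ (hx ξ hξ)
  rw [principalGroup, Subgroup.sup_eq_closure] at hg
  induction hg using Subgroup.closure_induction'' with
  | one => exact hgen 1 (Or.inl (one_mem 𝒜))
  | mem x hx => exact hgen x hx
  | inv_mem x hx => exact hgen x⁻¹ (hx.imp inv_mem inv_mem)
  | mul x y _ _ hx hy => exact hmul x y hx hy

theorem exists_isSectionPartition {𝒜 ℬ : Subgroup (TreeAut m)} (h𝒜 : ∀ a ∈ 𝒜, IsDirected a)
    (hℬ : ∀ b ∈ ℬ, IsRooted b) (S : Finset (TreeAut m)) (hS : ∀ s ∈ S, s ∈ principalGroup 𝒜 ℬ) :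
    ∃ (n₀ : ℕ) (F : Set (Level m n₀)), ∀ j : ℕ,
      IsSectionPartition 𝒜 ℬ S (n₀ + (j + 1))
        {v | ∃ w ∈ F, v = append w (zeroWord (shift m n₀) (j + 1))}
        {v | ∃ w ∈ F, ∃ u : Level (shift m n₀) (j + 1),
          IsRayNeighbour u ∧ v = append w u} := by
  choose! E hEfin hE0 hE using fun s (hs : s ∈ S) => (exists_sectionsAlong h𝒜 hℬ (hS s hs)).1
  have hfin : (⋃ s ∈ S, E s).Finite := S.finite_toSet.biUnion hEfin
  have hall : ∀ s ∈ S, SectionsAlong 𝒜 ℬ s (⋃ s ∈ S, E s) := fun s hs =>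
    (hE s hs).mono (Set.subset_biUnion_of_mem (u := E) hs)
  have hzero : ∀ ξ ∈ ⋃ s ∈ S, E s, EventuallyZero ξ := by
    intro ξ hξ
    obtain ⟨s, hs, hξ⟩ := Set.mem_iUnion₂.1 hξ
    exact hE0 s hs ξ hξ
  generalize (⋃ s ∈ S, E s) = R at hfin hall hzero
  obtain ⟨n₀, hn₀⟩ := Filter.eventually_atTop.1 ((Filter.eventually_all_finite hfin).2 hzero)
  have htail : ∀ ξ ∈ R, tailRay n₀ ξ = zeroRay (shift m n₀) := fun ξ hξ =>
    funext fun i => hn₀ (n₀ + i) (Nat.le_add_right _ _) ξ hξ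
  have htrunc : ∀ ξ ∈ R, ∀ k, truncRay ξ (n₀ + k)
      = append (truncRay ξ n₀) (zeroWord (shift m n₀) k) := fun ξ hξ k => by
    rw [← append_truncRay, htail ξ hξ]
    rfl
  have hparent : ∀ (w : Level m n₀) (j : ℕ) (u : Level (shift m n₀) (j + 1)),
      parent (n := n₀ + j) (append w u : Level m (n₀ + (j + 1))) = append w (parent u) := by
    intro w j u
    rw [← append_take_drop n₀ j (parent (n := n₀ + j) (append w u : Level m (n₀ + (j + 1))))]
    congr 1
    · exact takeWord_append w u
    · exact congrArg parent (dropWord_append w u)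
  have hnb : ∀ ξ ∈ R, ∀ (j : ℕ) (v : Level m (n₀ + (j + 1))),
      IsNeighbourOf ξ (n := n₀ + j + 1) v ↔
        ∃ u : Level (shift m n₀) (j + 1), IsRayNeighbour u ∧ v = append (truncRay ξ n₀) u := by
    intro ξ hξ j v
    constructor
    · rintro ⟨h1, h2⟩
      rw [← append_take_drop n₀ (j + 1) v, hparent, htrunc ξ hξ] at h1
      have h3 := congrArg (takeWord n₀ j) h1
      have h4 := congrArg (dropWord n₀ j) h1
      rw [takeWord_append, takeWord_append] at h3
      rw [dropWord_append, dropWord_append] at h4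
      have hv : v = append (truncRay ξ n₀) (dropWord n₀ (j + 1) v) := by
        rw [← h3, append_take_drop]
      refine ⟨_, ⟨h4, fun h5 => h2 ?_⟩, hv⟩
      rw [hv, h5]
      exact (htrunc ξ hξ (j + 1)).symm
    · rintro ⟨u, ⟨h1, h2⟩, rfl⟩
      refine ⟨?_, fun h3 => h2 ?_⟩
      · rw [hparent, h1, htrunc ξ hξ]
      · have h4 := congrArg (dropWord n₀ (j + 1)) (h3.trans (htrunc ξ hξ (j + 1)))
        rwa [dropWord_append, dropWord_append] at h4
  refine ⟨n₀, (truncRay · n₀) '' R, fun j => ⟨?_, fun s hs v hv => ?_, fun s hs v hv => ?_,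
    fun s hs v hv hv' => ?_⟩⟩
  · rw [Set.disjoint_left]
    rintro v ⟨w, -, rfl⟩ ⟨w', -, u, hu, h⟩
    have h4 := congrArg (dropWord n₀ (j + 1)) h
    rw [dropWord_append, dropWord_append] at h4
    exact hu.2 h4.symm
  · refine (hall s hs).mem_ray (n₀ + j) v fun ξ hξ h => ?_
    obtain ⟨w, -, rfl⟩ := hv
    obtain ⟨u, hu, h⟩ := (hnb ξ hξ j _).1 h
    have h4 := congrArg (dropWord n₀ (j + 1)) h
    rw [dropWord_append, dropWord_append] at h4
    exact hu.2 h4.symm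
  · refine (hall s hs).mem_neighbour (n₀ + j) v fun ξ hξ h => ?_
    obtain ⟨w, -, u, hu, rfl⟩ := hv
    have h4 := congrArg (dropWord n₀ (j + 1)) (h.trans (htrunc ξ hξ (j + 1)))
    rw [dropWord_append, dropWord_append] at h4
    exact hu.2 h4
  · refine (hall s hs).eq_one (n₀ + j) v (fun ξ hξ h => hv' ?_) fun ξ hξ h => hv ?_
    · obtain ⟨u, hu, h⟩ := (hnb ξ hξ j v).1 h
      exact ⟨_, ⟨ξ, hξ, rfl⟩, u, hu, h⟩
    · exact ⟨_, ⟨ξ, hξ, rfl⟩, h.trans (htrunc ξ hξ (j + 1))⟩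

end

section

/-! ### Random walks on finite sets and effective conductance -/

section Walk

variable {G V : Type*} [Group G] (ρ : G →* Equiv.Perm V) (S : Finset G)

/-- The expected value of `f` after one step from `v` of the random walk on `V` that is driven by
the weights `μ` on `S`. -/
noncomputable def stepMean (μ : G → ℝ≥0∞) (f : V → ℝ≥0∞) (v : V) : ℝ≥0∞ :=
  ∑ s ∈ S, μ s * f (ρ s v)

variable {S} in
theorem stepMean_mono (μ : G → ℝ≥0∞) {f g : V → ℝ≥0∞} (h : ∀ v, f v ≤ g v) (v : V) :
    stepMean ρ S μ f v ≤ stepMean ρ S μ g v :=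
  Finset.sum_le_sum fun _ _ => mul_le_mul_right (h _) _

theorem stepMean_add (μ : G → ℝ≥0∞) (f g : V → ℝ≥0∞) (v : V) :
    stepMean ρ S μ (fun v => f v + g v) v = stepMean ρ S μ f v + stepMean ρ S μ g v := by
  simp only [stepMean, mul_add, Finset.sum_add_distrib]

theorem stepMean_const {μ : G → ℝ≥0∞} (hμ : ∑ s ∈ S, μ s = 1) (c : ℝ≥0∞) (v : V) :
    stepMean ρ S μ (fun _ => c) v = c := by
  simp only [stepMean, ← Finset.sum_mul, hμ, one_mul]

/-- The counting measure is stationary. -/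
theorem sum_stepMean [Fintype V] {μ : G → ℝ≥0∞} (hμ : ∑ s ∈ S, μ s = 1) (f : V → ℝ≥0∞) :
    ∑ v, stepMean ρ S μ f v = ∑ v, f v := by
  simp only [stepMean]
  rw [Finset.sum_comm]
  simp only [← Finset.mul_sum, Equiv.sum_comp]
  rw [← Finset.sum_mul, hμ, one_mul]

open Classical in
/-- The probability that the walk visits `A`, and does so before it visits `B`, is a function that
is harmonic off `A ∪ B`. It is constructed as a least fixed point. -/
theorem exists_harmonic {μ : G → ℝ≥0∞} (hμ : ∑ s ∈ S, μ s = 1) {A B : Set V}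
    (hAB : Disjoint A B) :
    ∃ φ : V → ℝ≥0∞, (∀ v, φ v ≤ 1) ∧ (∀ v ∈ A, φ v = 1) ∧ (∀ v ∈ B, φ v = 0) ∧
      ∀ v, v ∉ A → v ∉ B → φ v = stepMean ρ S μ φ v := by
  let T : (V → ℝ≥0∞) →o (V → ℝ≥0∞) :=
    { toFun := fun f v => if v ∈ A then 1 else if v ∈ B then 0 else stepMean ρ S μ f v
      monotone' := fun f g hfg v => by
        dsimp only
        split_ifs
        · exact le_rfl
        · exact le_rfl
        · exact stepMean_mono ρ μ hfg v }
  have hT : ∀ v, T.lfp v = if v ∈ A then 1 else if v ∈ B then 0 else stepMean ρ S μ T.lfp v :=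
    fun v => (congrFun T.map_lfp v).symm
  refine ⟨T.lfp, ?_, fun v hv => ?_, fun v hv => ?_, fun v hA hB => ?_⟩
  · refine T.lfp_le (a := fun _ => 1) fun v => ?_
    show (if v ∈ A then 1 else if v ∈ B then 0 else stepMean ρ S μ (fun _ => 1) v) ≤ (1 : ℝ≥0∞)
    rw [stepMean_const ρ S hμ]
    split_ifs <;> simp
  · rw [hT, if_pos hv]
  · rw [hT, if_neg (Set.disjoint_right.1 hAB hv), if_pos hv]
  · rw [hT, if_neg hA, if_neg hB]

variable [Fintype V]

/-- Summation by parts for a symmetric random walk. -/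
theorem half_sum_mul_sub_mul_sub (hS : ∀ s ∈ S, s⁻¹ ∈ S) {p : G → ℝ}
    (hp : ∀ g, p g⁻¹ = p g) (hp1 : ∑ s ∈ S, p s = 1) (f g : V → ℝ) :
    1 / 2 * ∑ s ∈ S, p s * ∑ v, (f v - f (ρ s v)) * (g v - g (ρ s v))
      = ∑ v, f v * (g v - ∑ s ∈ S, p s * g (ρ s v)) := by
  have hinv : ∑ s ∈ S, p s * ∑ v, f (ρ s v) * g v = ∑ s ∈ S, p s * ∑ v, f v * g (ρ s v) := by
    refine Finset.sum_nbij' (·⁻¹) (·⁻¹) hS hS (fun s _ => inv_inv s) (fun s _ => inv_inv s)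
      fun s _ => ?_
    rw [hp, ← Equiv.sum_comp (ρ s) (fun v => f v * g (ρ s⁻¹ v))]
    simp
  have hdiag : ∀ s, ∑ v, f (ρ s v) * g (ρ s v) = ∑ v, f v * g v := fun s =>
    Equiv.sum_comp (ρ s) (fun v => f v * g v)
  have hL : ∑ s ∈ S, p s * ∑ v, (f v - f (ρ s v)) * (g v - g (ρ s v))
      = 2 * (∑ v, f v * g v) - 2 * ∑ s ∈ S, p s * ∑ v, f v * g (ρ s v) := by
    have h1 : ∀ s, ∑ v, (f v - f (ρ s v)) * (g v - g (ρ s v))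
        = 2 * (∑ v, f v * g v) - ∑ v, f v * g (ρ s v) - ∑ v, f (ρ s v) * g v := fun s => by
      have h2 := hdiag s
      rw [two_mul]
      nth_rewrite 2 [← h2]
      rw [← Finset.sum_add_distrib, ← Finset.sum_sub_distrib, ← Finset.sum_sub_distrib]
      exact Finset.sum_congr rfl fun v _ => by ring
    simp only [h1]
    simp only [mul_sub, Finset.sum_sub_distrib]
    rw [hinv, ← Finset.sum_mul, hp1]
    ring
  have hR : ∑ v, f v * ∑ s ∈ S, p s * g (ρ s v) = ∑ s ∈ S, p s * ∑ v, f v * g (ρ s v) := by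
    simp only [Finset.mul_sum]
    rw [Finset.sum_comm]
    exact Finset.sum_congr rfl fun s _ => Finset.sum_congr rfl fun v _ => by ring
  rw [hL]
  simp only [mul_sub, Finset.sum_sub_distrib]
  rw [hR]
  ring

/-- The flow of a harmonic function into `B` is its energy, and so at most the energy of any
other function with the same boundary values. -/
theorem sum_indicator_le_energy (hS : ∀ s ∈ S, s⁻¹ ∈ S) {p : G → ℝ} (hp0 : ∀ g, 0 ≤ p g)
    (hp : ∀ g, p g⁻¹ = p g) (hp1 : ∑ s ∈ S, p s = 1) {A B : Set V} (hAB : Disjoint A B)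
    {φ f : V → ℝ} (hφA : ∀ v ∈ A, φ v = 1) (hφB : ∀ v ∈ B, φ v = 0)
    (hφ : ∀ v, v ∉ A → v ∉ B → φ v = ∑ s ∈ S, p s * φ (ρ s v))
    (hfA : ∀ v ∈ A, f v = 1) (hfB : ∀ v ∈ B, f v = 0) :
    ∑ v, B.indicator (fun v => ∑ s ∈ S, p s * φ (ρ s v)) v
      ≤ 1 / 2 * ∑ s ∈ S, p s * ∑ v, (f v - f (ρ s v)) * (f v - f (ρ s v)) := by
  have green := half_sum_mul_sub_mul_sub ρ S hS hp hp1
  set Δ : V → ℝ := fun v => φ v - ∑ s ∈ S, p s * φ (ρ s v) with hΔ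
  have hpair : ∀ g : V → ℝ, (∀ v ∈ A, g v = 1) → (∀ v ∈ B, g v = 0) →
      ∑ v, g v * Δ v = ∑ v, A.indicator Δ v := by
    intro g hA hB
    refine Finset.sum_congr rfl fun v _ => ?_
    by_cases hvA : v ∈ A
    · rw [hA v hvA, Set.indicator_of_mem hvA, one_mul]
    · rw [Set.indicator_of_notMem hvA]
      by_cases hvB : v ∈ B
      · rw [hB v hvB, zero_mul]
      · have h0 : Δ v = 0 := sub_eq_zero.2 (hφ v hvA hvB)
        rw [h0, mul_zero]
  have hflow : ∑ v, B.indicator (fun v => ∑ s ∈ S, p s * φ (ρ s v)) v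
      = ∑ v, A.indicator Δ v := by
    have h0 : ∑ v, Δ v = 0 := by
      have h1 := green (fun _ => 1) φ
      simpa [hΔ] using h1.symm
    rw [← sub_eq_zero, ← neg_eq_zero, neg_sub, ← Finset.sum_sub_distrib, ← h0]
    refine Finset.sum_congr rfl fun v _ => ?_
    by_cases hvA : v ∈ A
    · rw [Set.indicator_of_mem hvA, Set.indicator_of_notMem (Set.disjoint_left.1 hAB hvA), sub_zero]
    · rw [Set.indicator_of_notMem hvA]
      by_cases hvB : v ∈ B
      · rw [Set.indicator_of_mem hvB, hΔ]
        simp only [hφB v hvB]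
      · rw [Set.indicator_of_notMem hvB, sub_zero]
        exact (sub_eq_zero.2 (hφ v hvA hvB)).symm
  have h1 := green f φ
  have h2 := green φ φ
  rw [hpair f hfA hfB] at h1
  rw [hpair φ hφA hφB] at h2
  rw [hflow]
  -- the energy of `f - φ` is nonnegative
  have h3 : 0 ≤ ∑ s ∈ S, p s * ∑ v, ((f v - φ v) - (f (ρ s v) - φ (ρ s v))) ^ 2 :=
    Finset.sum_nonneg fun s _ => mul_nonneg (hp0 s) (Finset.sum_nonneg fun v _ => sq_nonneg _)
  have h4 : ∑ s ∈ S, p s * ∑ v, ((f v - φ v) - (f (ρ s v) - φ (ρ s v))) ^ 2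
      = ∑ s ∈ S, p s * ∑ v, (f v - f (ρ s v)) * (f v - f (ρ s v))
        - 2 * ∑ s ∈ S, p s * ∑ v, (f v - f (ρ s v)) * (φ v - φ (ρ s v))
        + ∑ s ∈ S, p s * ∑ v, (φ v - φ (ρ s v)) * (φ v - φ (ρ s v)) := by
    rw [Finset.mul_sum, ← Finset.sum_sub_distrib, ← Finset.sum_add_distrib]
    refine Finset.sum_congr rfl fun s _ => ?_
    have h5 : ∑ v, ((f v - φ v) - (f (ρ s v) - φ (ρ s v))) ^ 2
        = ∑ v, (f v - f (ρ s v)) * (f v - f (ρ s v))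
          - 2 * ∑ v, (f v - f (ρ s v)) * (φ v - φ (ρ s v))
          + ∑ v, (φ v - φ (ρ s v)) * (φ v - φ (ρ s v)) := by
      rw [Finset.mul_sum, ← Finset.sum_sub_distrib, ← Finset.sum_add_distrib]
      exact Finset.sum_congr rfl fun v _ => by ring
    rw [h5]
    ring
  linarith

end Walk

variable {m : ℕ → ℕ}

/-- The action on the vertices of level `n` as a homomorphism. -/
def levelHom (m : ℕ → ℕ) (n : ℕ) : TreeAut m →* Equiv.Perm (Level m n) :=
  (Pi.evalMonoidHom _ n).comp (TreeAut m).subtype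

theorem levelHom_apply (n : ℕ) (g : TreeAut m) (v : Level m n) : levelHom m n g v = act g v := rfl

theorem dirichletEnergy_schreierConductance (S : Finset (TreeAut m)) (n : ℕ)
    (f : Level m n → ℝ) :
    dirichletEnergy (schreierConductance S n) f
      = 1 / 2 * ∑ s ∈ S, ∑ v, (f v - f (act s v)) ^ 2 := by
  classical
  rw [dirichletEnergy, Finset.sum_comm (s := S)]
  congr 1
  refine Finset.sum_congr rfl fun v _ => ?_
  simp only [schreierConductance, Finset.natCast_card_filter, Finset.sum_mul]
  rw [Finset.sum_comm]
  refine Finset.sum_congr rfl fun s _ => ?_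
  rw [Finset.sum_eq_single (act s v)]
  · simp
  · intro w _ hw
    rw [if_neg (Ne.symm hw), zero_mul]
  · intro h
    exact (h (Finset.mem_univ _)).elim

/-- The function of `exists_harmonic` has a flow into `B` that is at most the effective
conductance: the weights of the walk are at most `1`. -/
theorem exists_harmonic_flow_le (S : Finset (TreeAut m)) (hS : ∀ s ∈ S, s⁻¹ ∈ S)
    (μ : PMF (TreeAut m)) (hμ : ∀ g, μ g⁻¹ = μ g) (hμ1 : ∑ s ∈ S, μ s = 1) (n : ℕ)
    {A B : Set (Level m n)} (hAB : Disjoint A B) :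
    ∃ φ : Level m n → ℝ≥0∞, (∀ v ∈ A, φ v = 1) ∧ (∀ v ∈ B, φ v = 0) ∧
      (∀ v, v ∉ A → v ∉ B → φ v = stepMean (levelHom m n) S μ φ v) ∧
      ∑ v, B.indicator (stepMean (levelHom m n) S μ φ) v
        ≤ effectiveConductance (schreierConductance S n) A B := by
  classical
  obtain ⟨φ, hφ1, hφA, hφB, hφ⟩ := exists_harmonic (levelHom m n) S hμ1 hAB
  refine ⟨φ, hφA, hφB, hφ, le_iInf₂ fun f hf => ?_⟩
  have hfin : ∀ v, φ v ≠ ∞ := fun v => ((hφ1 v).trans_lt ENNReal.one_lt_top).ne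
  have hmean : ∀ v, (stepMean (levelHom m n) S μ φ v).toReal
      = ∑ s ∈ S, (μ s).toReal * (φ (levelHom m n s v)).toReal := fun v => by
    rw [stepMean, ENNReal.toReal_sum fun s _ => ENNReal.mul_ne_top (μ.apply_ne_top s) (hfin _)]
    simp only [ENNReal.toReal_mul]
  have hmean_fin : ∀ v, stepMean (levelHom m n) S μ φ v ≠ ∞ := fun v =>
    ENNReal.sum_ne_top.2 fun s _ => ENNReal.mul_ne_top (μ.apply_ne_top s) (hfin _)
  have hreal := sum_indicator_le_energy (levelHom m n) S hS (p := fun g => (μ g).toReal)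
    (fun g => ENNReal.toReal_nonneg) (fun g => by rw [hμ])
    (by rw [← ENNReal.toReal_sum fun s _ => μ.apply_ne_top s, hμ1, ENNReal.toReal_one]) hAB
    (φ := fun v => (φ v).toReal) (fun v hv => by simp [hφA v hv]) (fun v hv => by simp [hφB v hv])
    (fun v hA hB => by rw [← hmean, ← hφ v hA hB]) hf.1 hf.2
  have hle : 1 / 2 * ∑ s ∈ S, (μ s).toReal *
        ∑ v, (f v - f (levelHom m n s v)) * (f v - f (levelHom m n s v))
      ≤ dirichletEnergy (schreierConductance S n) f := by
    rw [dirichletEnergy_schreierConductance]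
    refine mul_le_mul_of_nonneg_left (Finset.sum_le_sum fun s _ => ?_) (by norm_num)
    have h1 : (μ s).toReal ≤ 1 := by
      rw [← ENNReal.toReal_one]
      exact ENNReal.toReal_mono ENNReal.one_ne_top (μ.coe_le_one s)
    simp only [levelHom_apply, ← sq]
    exact mul_le_of_le_one_left (Finset.sum_nonneg fun v _ => sq_nonneg _) h1
  have hind : ∀ v, B.indicator (stepMean (levelHom m n) S μ φ) v = ENNReal.ofReal
      (B.indicator (fun v => ∑ s ∈ S, (μ s).toReal * (φ (levelHom m n s v)).toReal) v) := by
    intro v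
    by_cases hv : v ∈ B
    · rw [Set.indicator_of_mem hv, Set.indicator_of_mem hv, ← hmean,
        ENNReal.ofReal_toReal (hmean_fin v)]
    · rw [Set.indicator_of_notMem hv, Set.indicator_of_notMem hv, ENNReal.ofReal_zero]
  simp only [hind]
  rw [← ENNReal.ofReal_sum_of_nonneg]
  · exact ENNReal.ofReal_le_ofReal (hreal.trans hle)
  · intro v _
    refine Set.indicator_nonneg (fun v _ => Finset.sum_nonneg fun s _ => ?_) v
    exact mul_nonneg ENNReal.toReal_nonneg ENNReal.toReal_nonneg

end

section

/-! ### Entropy -/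

/-- Gibbs' inequality: the entropy is at most the mean code length for any weights `q` of total
mass at most `1`. -/
theorem entropy_le_sum_neg_log {E : Type*} (ν : PMF E) (T : Finset E) (hT : ∀ x, x ∉ T → ν x = 0)
    (q : E → ℝ) (hq : ∀ x, 0 < q x) (hq1 : ∑ x ∈ T, q x ≤ 1) :
    entropy ν ≤ ∑ x ∈ T, ν x * ENNReal.ofReal (-Real.log (q x)) := by
  have hsum : ∑ x ∈ T, ν x = 1 := by
    rw [← ν.tsum_coe, tsum_eq_sum fun x hx => hT x hx]
  have hsum' : ∑ x ∈ T, (ν x).toReal = 1 := by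
    rw [← ENNReal.toReal_sum fun x _ => ν.apply_ne_top x, hsum, ENNReal.toReal_one]
  have hle1 : ∀ x, (ν x).toReal ≤ 1 := fun x => by
    rw [← ENNReal.toReal_one]
    exact ENNReal.toReal_mono ENNReal.one_ne_top (ν.coe_le_one x)
  have hpt : ∀ x, Real.negMulLog (ν x).toReal
      ≤ (ν x).toReal * -Real.log (q x) + (q x - (ν x).toReal) := by
    intro x
    have h0 : 0 ≤ (ν x).toReal := ENNReal.toReal_nonneg
    generalize (ν x).toReal = p at h0
    rcases h0.eq_or_lt with rfl | hp
    · simpa using (hq x).le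
    · have h1 := Real.log_le_sub_one_of_pos (div_pos (hq x) hp)
      rw [Real.log_div (hq x).ne' hp.ne'] at h1
      have h2 := mul_le_mul_of_nonneg_left h1 hp.le
      have h3 : p * (q x / p - 1) = q x - p := by field_simp
      rw [h3] at h2
      rw [Real.negMulLog]
      linarith
  have hreal : ∑ x ∈ T, Real.negMulLog (ν x).toReal
      ≤ ∑ x ∈ T, (ν x).toReal * -Real.log (q x) := by
    have h1 := Finset.sum_le_sum fun x (_ : x ∈ T) => hpt x
    rw [Finset.sum_add_distrib, Finset.sum_sub_distrib, hsum'] at h1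
    linarith
  rw [entropy, tsum_eq_sum (s := T) fun x hx => by rw [hT x hx]; simp,
    ← ENNReal.ofReal_sum_of_nonneg fun x _ =>
      Real.negMulLog_nonneg ENNReal.toReal_nonneg (hle1 x)]
  refine (ENNReal.ofReal_le_ofReal hreal).trans ?_
  refine (Finset.le_sum_of_subadditive ENNReal.ofReal ENNReal.ofReal_zero.le
    (fun _ _ => ENNReal.ofReal_add_le) _ _).trans (Finset.sum_le_sum fun x _ => ?_)
  rw [ENNReal.ofReal_mul ENNReal.toReal_nonneg, ENNReal.ofReal_toReal (ν.apply_ne_top x)]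

theorem finite_support_convPow {G : Type*} [Group G] (μ : PMF G) (hμ : μ.support.Finite) (k : ℕ) :
    (convPow μ k).support.Finite := by
  induction k with
  | zero =>
    rw [convPow, PMF.support_pure]
    exact Set.finite_singleton _
  | succ k ih =>
    rw [convPow, PMF.support_bind]
    refine ih.biUnion fun g _ => ?_
    rw [PMF.support_map]
    exact hμ.image _

theorem tsum_bind_mul {α β : Type*} (p : PMF α) (f : α → PMF β) (F : β → ℝ≥0∞) :
    ∑' b, p.bind f b * F b = ∑' a, p a * ∑' b, f a b * F b := by
  simp only [PMF.bind_apply, ← ENNReal.tsum_mul_right, ← ENNReal.tsum_mul_left]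
  rw [ENNReal.tsum_comm]
  simp only [mul_assoc]

theorem tsum_map_mul {α β : Type*} (p : PMF α) (f : α → β) (F : β → ℝ≥0∞) :
    ∑' b, p.map f b * F b = ∑' a, p a * F (f a) := by
  rw [PMF.map, tsum_bind_mul]
  congr 1
  funext a
  congr 1
  rw [tsum_eq_single (f a)]
  · simp
  · intro b hb
    simp [hb]

/-- The mean over a product of `k + 1` random factors, in terms of the rightmost factor, which is
the first to act. -/
theorem tsum_convPow_succ_mul {G : Type*} [Group G] (μ : PMF G) (S : Finset G)
    (hμ : ∀ g, μ g ≠ 0 → g ∈ S) (k : ℕ) (F : G → ℝ≥0∞) :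
    ∑' g, convPow μ (k + 1) g * F g
      = ∑ s ∈ S, μ s * ∑' g, convPow μ k g * F (g * s) := by
  rw [convPow, tsum_bind_mul]
  simp only [tsum_map_mul]
  have h : ∀ g, ∑' s, μ s * F (g * s) = ∑ s ∈ S, μ s * F (g * s) := fun g =>
    tsum_eq_sum fun s hs => by
      rw [not_not.1 (mt (hμ s) hs), zero_mul]
  simp only [h, Finset.mul_sum, ← ENNReal.tsum_mul_left]
  rw [Summable.tsum_finsetSum fun _ _ => ENNReal.summable]
  simp only [mul_left_comm]

/-! ### Alternating products in two finite groups -/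

section Alternating

open scoped Pointwise

variable {H : Type*} [Group H] (P Q : Subgroup H)

/-- The least number of alternations in a product of elements of `P` and `Q`, read from right to
left: the least `j` such that `x` is a product of `j + 1` factors in `Q * P`; it is `∞` if `x` is no
such product. -/
noncomputable def altLength (x : H) : ℝ≥0∞ :=
  ⨅ (j : ℕ) (_ : x ∈ ((Q : Set H) * (P : Set H)) ^ (j + 1)), (j : ℝ≥0∞)

/-- The variant of `altLength` for products that begin, on the right, with an element of `Q`. -/
noncomputable def altLength' (x : H) : ℝ≥0∞ :=
  ⨅ (j : ℕ) (_ : x ∈ ((Q : Set H) * (P : Set H)) ^ j * (Q : Set H)), (j : ℝ≥0∞)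

theorem altLength_one : altLength P Q 1 = 0 := by
  refine le_antisymm (iInf₂_le_of_le 0 ?_ (by simp)) (zero_le)
  rw [zero_add, pow_one]
  exact ⟨1, one_mem Q, 1, one_mem P, one_mul 1⟩

theorem altLength'_one : altLength' P Q 1 = 0 := by
  refine le_antisymm (iInf₂_le_of_le 0 ?_ (by simp)) (zero_le)
  rw [pow_zero, one_mul]
  exact one_mem Q

variable {P Q}

theorem altLength_mul_left_le (x : H) {p : H} (hp : p ∈ P) :
    altLength P Q (x * p) ≤ altLength P Q x := by
  refine le_iInf₂ fun j hx => iInf₂_le j ?_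
  rw [pow_succ] at hx ⊢
  obtain ⟨y, hy, _, ⟨q, hq, p', hp', rfl⟩, rfl⟩ := hx
  exact ⟨y, hy, q * (p' * p), ⟨q, hq, p' * p, mul_mem hp' hp, rfl⟩, by simp only [mul_assoc]⟩

theorem altLength'_mul_left_le (x : H) {p : H} (hp : p ∈ P) :
    altLength' P Q (x * p) ≤ altLength P Q x + 1 := by
  have h : altLength' P Q (x * p) ≤ altLength P Q (x * p) + 1 := by
    rw [altLength, ENNReal.iInf_add]
    refine le_iInf fun j => ?_
    rw [ENNReal.iInf_add]
    refine le_iInf fun hx => iInf₂_le_of_le (j + 1) ⟨_, hx, 1, one_mem Q, mul_one _⟩ ?_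
    rw [Nat.cast_succ]
  exact h.trans (add_le_add_left (altLength_mul_left_le x hp) 1)

theorem altLength_mul_right_le (x : H) {q : H} (hq : q ∈ Q) :
    altLength P Q (x * q) ≤ altLength' P Q x := by
  refine le_iInf₂ fun j hx => iInf₂_le j ?_
  obtain ⟨y, hy, q', hq', rfl⟩ := hx
  rw [pow_succ]
  exact ⟨y, hy, q' * q, ⟨q' * q, mul_mem hq' hq, 1, one_mem P, mul_one _⟩, (mul_assoc ..).symm⟩

theorem altLength'_mul_right_le (x : H) {q : H} (hq : q ∈ Q) :
    altLength' P Q (x * q) ≤ altLength' P Q x := by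
  refine le_iInf₂ fun j hx => iInf₂_le j ?_
  obtain ⟨y, hy, q', hq', rfl⟩ := hx
  exact ⟨y, hy, q' * q, mul_mem hq' hq, (mul_assoc ..).symm⟩

theorem exists_altLength_eq {x : H} (hx : altLength P Q x ≠ ∞) :
    ∃ j : ℕ, x ∈ ((Q : Set H) * (P : Set H)) ^ (j + 1) ∧ altLength P Q x = j := by
  classical
  have hex : ∃ j : ℕ, x ∈ ((Q : Set H) * (P : Set H)) ^ (j + 1) := by
    by_contra! h
    refine hx ?_
    simp [altLength, h]
  refine ⟨Nat.find hex, Nat.find_spec hex,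
    le_antisymm (iInf₂_le_of_le _ (Nat.find_spec hex) le_rfl) ?_⟩
  exact le_iInf₂ fun j hj => Nat.cast_le.2 (Nat.find_min' hex hj)

theorem finite_pow_and_ncard_le [Finite P] [Finite Q] (j : ℕ) :
    (((Q : Set H) * (P : Set H)) ^ j).Finite ∧
      (((Q : Set H) * (P : Set H)) ^ j).ncard ≤ (Nat.card P * Nat.card Q) ^ j := by
  have hfin : ((Q : Set H) * (P : Set H)).Finite :=
    (Set.toFinite (Q : Set H)).mul (Set.toFinite (P : Set H))
  have hcard : ((Q : Set H) * (P : Set H)).ncard ≤ Nat.card P * Nat.card Q := by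
    rw [mul_comm (Nat.card P)]
    exact Set.natCard_mul_le
  induction j with
  | zero => simp [← Set.singleton_one]
  | succ j ih =>
    rw [pow_succ, pow_succ]
    exact ⟨ih.1.mul hfin, Set.natCard_mul_le.trans (Nat.mul_le_mul ih.2 hcard)⟩

/-- If at most `K ^ (j + 1)` elements have length `j`, the weights `(2 * K) ^ (-(j + 1))` have total
mass at most `1`. -/
theorem sum_inv_pow_le_one {X : Type*} (T : Finset X) (ℓ : X → ℕ) {K : ℕ} (hK : 0 < K)
    (U : ℕ → Set X) (hU : ∀ j, (U j).Finite) (hcard : ∀ j, (U j).ncard ≤ K ^ (j + 1))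
    (hT : ∀ x ∈ T, x ∈ U (ℓ x)) : ∑ x ∈ T, ((2 * K : ℝ)⁻¹) ^ (ℓ x + 1) ≤ 1 := by
  classical
  have hK' : (0 : ℝ) < K := Nat.cast_pos.2 hK
  rw [← Finset.sum_fiberwise_of_maps_to (t := T.image ℓ)
    fun x hx => Finset.mem_image_of_mem ℓ hx]
  have hfib : ∀ j, ∑ x ∈ T with ℓ x = j, ((2 * K : ℝ)⁻¹) ^ (ℓ x + 1) ≤ (1 / 2) ^ j * (1 / 2) := by
    intro j
    have h1 : ∑ x ∈ T with ℓ x = j, ((2 * K : ℝ)⁻¹) ^ (ℓ x + 1)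
        = ((T.filter (ℓ · = j)).card : ℝ) * ((2 * K : ℝ)⁻¹) ^ (j + 1) := by
      rw [← nsmul_eq_mul]
      refine Finset.sum_eq_card_nsmul fun x hx => ?_
      rw [(Finset.mem_filter.1 hx).2]
    have h2 : (T.filter (ℓ · = j)).card ≤ K ^ (j + 1) := by
      refine le_trans ?_ (hcard j)
      rw [← Set.ncard_coe_finset]
      refine Set.ncard_le_ncard (fun x hx => ?_) (hU j)
      have hx' := Finset.mem_filter.1 (Finset.mem_coe.1 hx)
      rw [← hx'.2]
      exact hT x hx'.1
    have h3 : ((T.filter (ℓ · = j)).card : ℝ) ≤ (K : ℝ) ^ (j + 1) := by exact_mod_cast h2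
    rw [h1]
    refine (mul_le_mul_of_nonneg_right h3 (by positivity)).trans (le_of_eq ?_)
    rw [← pow_succ, ← mul_pow]
    congr 1
    field_simp
  have hsum : Summable fun j : ℕ => (1 / 2 : ℝ) ^ j * (1 / 2) := summable_geometric_two.mul_right _
  refine (Finset.sum_le_sum fun j _ => hfib j).trans
    ((hsum.sum_le_tsum _ fun j _ => by positivity).trans (le_of_eq ?_))
  rw [tsum_mul_right, tsum_geometric_two]
  norm_num

end Alternating

/-! ### The entropy of the random walk -/

variable {m : ℕ → ℕ}

/-- A bound for the expected number of alternations in the section at `v` of the product of `k`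
random factors. For `φ` the probability that the walk visits `A` before `B`, it is the expected
total charge of the walk from `v`, where each visit to `B` is charged the mean of `φ` after one more
step, which is the probability that `A` is the next of the two sets to be visited. -/
noncomputable def altBound (S : Finset (TreeAut m)) (μ : PMF (TreeAut m)) {n : ℕ}
    (B : Set (Level m n)) (φ : Level m n → ℝ≥0∞) : ℕ → Level m n → ℝ≥0∞
  | 0, _ => 0
  | k + 1, v => stepMean (levelHom m n) S μ (altBound S μ B φ k) v
      + B.indicator (stepMean (levelHom m n) S μ φ) v

theorem sum_altBound (S : Finset (TreeAut m)) (μ : PMF (TreeAut m)) (hμ1 : ∑ s ∈ S, μ s = 1)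
    {n : ℕ} (B : Set (Level m n)) (φ : Level m n → ℝ≥0∞) (k : ℕ) :
    ∑ v, altBound S μ B φ k v = k * ∑ v, B.indicator (stepMean (levelHom m n) S μ φ) v := by
  induction k with
  | zero => simp [altBound]
  | succ k ih =>
    simp only [altBound]
    rw [Finset.sum_add_distrib, sum_stepMean _ _ hμ1, ih]
    push_cast
    ring

variable [∀ i, NeZero (m i)]

/-- The expected number of alternations in the section at `v` satisfies a recursion in the first
step of the walk from `v`. The two bounds are proved together, the second being for a walk that has
visited `B` last: if it comes to `A`, which happens with probability at most `φ v`, this is one more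
alternation. -/
theorem tsum_convPow_altLength_le {𝒜 ℬ : Subgroup (TreeAut m)} {S : Finset (TreeAut m)} {n : ℕ}
    {A B : Set (Level m n)} (h : IsSectionPartition 𝒜 ℬ S n A B) (μ : PMF (TreeAut m))
    (hμ : ∀ g, μ g ≠ 0 → g ∈ S) (hμ1 : ∑ s ∈ S, μ s = 1) {φ : Level m n → ℝ≥0∞}
    (hφA : ∀ v ∈ A, φ v = 1)
    (hφ : ∀ v, v ∉ A → v ∉ B → φ v = stepMean (levelHom m n) S μ φ v) (k : ℕ) (v : Level m n) :
    ∑' g, convPow μ k g * altLength (raySections 𝒜 n) (neighbourSections 𝒜 ℬ n) (sect g v)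
        ≤ altBound S μ B φ k v ∧
      ∑' g, convPow μ k g * altLength' (raySections 𝒜 n) (neighbourSections 𝒜 ℬ n) (sect g v)
        ≤ altBound S μ B φ k v + φ v := by
  induction k generalizing v with
  | zero =>
    have h0 : ∀ F : TreeAut m → ℝ≥0∞, F 1 = 0 → ∑' g, convPow μ 0 g * F g = 0 := by
      intro F hF
      refine ENNReal.tsum_eq_zero.2 fun g => ?_
      by_cases hg : g = 1
      · rw [hg, hF, mul_zero]
      · simp [convPow, hg]
    rw [h0 _ (by rw [sect_one, altLength_one]), h0 _ (by rw [sect_one, altLength'_one])]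
    exact ⟨zero_le, zero_le⟩
  | succ k ih =>
    have hstep : ∀ (F : TreeAut m → ℝ≥0∞) (F' : Level m n → TreeAut m → ℝ≥0∞)
        (f : Level m n → ℝ≥0∞), (∀ s ∈ S, ∀ g, F (g * s) ≤ F' (act s v) g) →
        (∀ w, ∑' g, convPow μ k g * F' w g ≤ f w) →
        ∑' g, convPow μ (k + 1) g * F g ≤ stepMean (levelHom m n) S μ f v := by
      intro F F' f hF hf
      rw [tsum_convPow_succ_mul μ S hμ]
      refine Finset.sum_le_sum fun s hs => mul_le_mul_right ?_ _
      exact (ENNReal.tsum_le_tsum fun g => mul_le_mul_right (hF s hs g) _).trans (hf (act s v))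
    by_cases hA : v ∈ A
    · have hB : v ∉ B := Set.disjoint_left.1 h.disjoint hA
      have hind : B.indicator (stepMean (levelHom m n) S μ φ) v = 0 := Set.indicator_of_notMem hB _
      rw [altBound, hind, add_zero, hφA v hA]
      constructor
      · refine hstep _ (fun w g => altLength _ _ (sect g w)) _ (fun s hs g => ?_) fun w => (ih w).1
        rw [sect_mul]
        exact altLength_mul_left_le _ (h.sect_mem_ray s hs v hA)
      · rw [← stepMean_const (levelHom m n) S hμ1 1 v, ← stepMean_add]
        refine hstep _ (fun w g =>
          altLength (raySections 𝒜 n) (neighbourSections 𝒜 ℬ n) (sect g w) + 1) _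
          (fun s hs g => ?_) fun w => ?_
        · rw [sect_mul]
          exact altLength'_mul_left_le _ (h.sect_mem_ray s hs v hA)
        · simp only [mul_add, mul_one]
          rw [ENNReal.tsum_add, PMF.tsum_coe]
          exact add_le_add_left (ih w).1 1
    · by_cases hB : v ∈ B
      · have hind : B.indicator (stepMean (levelHom m n) S μ φ) v
            = stepMean (levelHom m n) S μ φ v := Set.indicator_of_mem hB _
        rw [altBound, hind, ← stepMean_add]
        constructor
        · refine hstep _ (fun w g => altLength' _ _ (sect g w)) _ (fun s hs g => ?_)
            fun w => (ih w).2
          rw [sect_mul]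
          exact altLength_mul_right_le _ (h.sect_mem_neighbour s hs v hB)
        · refine le_add_right ?_
          refine hstep _ (fun w g => altLength' _ _ (sect g w)) _ (fun s hs g => ?_)
            fun w => (ih w).2
          rw [sect_mul]
          exact altLength'_mul_right_le _ (h.sect_mem_neighbour s hs v hB)
      · have hind : B.indicator (stepMean (levelHom m n) S μ φ) v = 0 :=
          Set.indicator_of_notMem hB _
        rw [altBound, hind, add_zero, hφ v hA hB, ← stepMean_add]
        constructor
        · refine hstep _ (fun w g => altLength _ _ (sect g w)) _ (fun s hs g => ?_)
            fun w => (ih w).1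
          rw [sect_mul, h.sect_eq_one s hs v hA hB, mul_one]
        · refine hstep _ (fun w g => altLength' _ _ (sect g w)) _ (fun s hs g => ?_)
            fun w => (ih w).2
          rw [sect_mul, h.sect_eq_one s hs v hA hB, mul_one]

open scoped Pointwise in
/-- The entropy of a random automorphism is controlled by the mean total number of alternations in
its sections, which together with the action on level `n` determine it. -/
theorem entropy_le_altLength (ν : PMF (TreeAut m)) (hν : ν.support.Finite) {M K : ℕ}
    (hM : ∀ i, m i ≤ M) (hK : 0 < K) {n : ℕ} (P Q : Subgroup (TreeAut (shift m n)))
    [Finite P] [Finite Q] (hPQ : Nat.card P * Nat.card Q ≤ K) :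
    entropy ν ≤ ENNReal.ofReal (Real.log ((M : ℝ) ^ M) + Real.log (2 * K)) *
      (levelSize m n + ∑' g, ν g * ∑ w : Level m n, altLength P Q (sect g w)) := by
  classical
  set T := hν.toFinset with hTdef
  have hT : ∀ g, g ∉ T → ν g = 0 := fun g hg => by
    simpa [hTdef, PMF.mem_support_iff] using hg
  have hT' : ∀ g ∈ T, ν g ≠ 0 := fun g hg => by
    simpa [hTdef, PMF.mem_support_iff] using hg
  have hsum : ∑ g ∈ T, ν g = 1 := by
    rw [← ν.tsum_coe, tsum_eq_sum fun x hx => hT x hx]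
  have hMM : (1 : ℝ) ≤ (M : ℝ) ^ M := by
    have h1 : 0 < M ^ M := (Nat.pow_pos (Nat.pos_of_neZero (m 0))).trans_le (pow_self_le hM 0)
    exact_mod_cast h1
  have hK1 : (1 : ℝ) ≤ K := Nat.one_le_cast.2 hK
  have hlogM : 0 ≤ Real.log ((M : ℝ) ^ M) := Real.log_nonneg hMM
  have hlogK : 0 < Real.log (2 * K) := Real.log_pos (by linarith)
  rw [tsum_eq_sum (s := T) fun g hg => by rw [hT g hg, zero_mul]]
  by_cases hfin : ∀ g ∈ T, ∀ w : Level m n, altLength P Q (sect g w) ≠ ∞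
  swap
  · push Not at hfin
    obtain ⟨g, hg, w, hw⟩ := hfin
    have h1 : ∑ w : Level m n, altLength P Q (sect g w) = ∞ :=
      ENNReal.sum_eq_top.2 ⟨w, Finset.mem_univ _, hw⟩
    have h2 : ∑ g ∈ T, ν g * ∑ w : Level m n, altLength P Q (sect g w) = ∞ :=
      ENNReal.sum_eq_top.2 ⟨g, hg, by rw [h1, ENNReal.mul_top (hT' g hg)]⟩
    rw [h2, add_top, ENNReal.mul_top (ENNReal.ofReal_pos.2 (by linarith)).ne']
    exact le_top
  have hlen : ∀ x : TreeAut (shift m n), ∃ j : ℕ, altLength P Q x ≠ ∞ →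
      x ∈ ((Q : Set (TreeAut (shift m n))) * (P : Set (TreeAut (shift m n)))) ^ (j + 1) ∧
        altLength P Q x = j := fun x => by
    by_cases hx : altLength P Q x ≠ ∞
    · obtain ⟨j, hj⟩ := exists_altLength_eq hx
      exact ⟨j, fun _ => hj⟩
    · exact ⟨0, fun h => (hx h).elim⟩
  choose ℓ hℓ using hlen
  set N : ℕ := (levelActions m n).ncard with hN
  have hNpos : 0 < N := (Set.ncard_pos (Set.toFinite _)).2 ⟨_, 1, rfl⟩
  have hN0 : (0 : ℝ) < N := Nat.cast_pos.2 hNpos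
  have hNle : (N : ℝ) ≤ ((M : ℝ) ^ M) ^ levelSize m n := by
    exact_mod_cast ncard_levelActions_le hM n
  set r : ℝ := (2 * K : ℝ)⁻¹ with hr
  have hr0 : 0 < r := by positivity
  -- the weight that corresponds to coding the action on level `n` and each section separately
  set q : TreeAut m → ℝ := fun g => (N : ℝ)⁻¹ * ∏ w : Level m n, r ^ (ℓ (sect g w) + 1) with hq
  have hq0 : ∀ g, 0 < q g := fun g => by positivity
  have hq1 : ∑ g ∈ T, q g ≤ 1 := by
    let code : TreeAut m → (Level m n → Level m n) × (Level m n → TreeAut (shift m n)) :=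
      fun g => (fun v => act g v, fun w => sect g w)
    have hinj : Function.Injective code := fun g h hgh =>
      eq_of_act_eq_of_sect_eq n (fun v => congrFun (congrArg Prod.fst hgh) v)
        fun w => congrFun (congrArg Prod.snd hgh) w
    let X := (Set.toFinite (levelActions m n)).toFinset ×ˢ
      Fintype.piFinset fun w : Level m n => T.image fun g => sect g w
    let Wt : (Level m n → Level m n) × (Level m n → TreeAut (shift m n)) → ℝ :=
      fun x => (N : ℝ)⁻¹ * ∏ w : Level m n, r ^ (ℓ (x.2 w) + 1)
    have hsub : T.image code ⊆ X := by
      intro x hx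
      obtain ⟨g, hg, rfl⟩ := Finset.mem_image.1 hx
      refine Finset.mem_product.2 ⟨(Set.Finite.mem_toFinset _).2 ⟨g, rfl⟩, ?_⟩
      exact Fintype.mem_piFinset.2 fun w => Finset.mem_image_of_mem (fun g => sect g w) hg
    calc ∑ g ∈ T, q g = ∑ x ∈ T.image code, Wt x :=
          (Finset.sum_image (f := Wt) fun g _ h _ e => hinj e).symm
      _ ≤ ∑ x ∈ X, Wt x := Finset.sum_le_sum_of_subset_of_nonneg hsub fun x _ _ => by positivity
      _ = N * ((N : ℝ)⁻¹ * ∏ w : Level m n,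
            ∑ x ∈ T.image (fun g => sect g w), r ^ (ℓ x + 1)) := by
          rw [Finset.sum_product]
          simp only [Wt]
          rw [Finset.sum_const, nsmul_eq_mul,
            ← Set.ncard_eq_toFinset_card _ (Set.toFinite _), Finset.prod_univ_sum]
          simp only [Finset.mul_sum, hN]
      _ ≤ N * ((N : ℝ)⁻¹ * 1) := by
          refine mul_le_mul_of_nonneg_left (mul_le_mul_of_nonneg_left ?_ (by positivity)) hN0.le
          refine Finset.prod_le_one (fun w _ => Finset.sum_nonneg fun x _ => by positivity)
            fun w _ => ?_
          refine sum_inv_pow_le_one _ ℓ hK _ (fun j => (finite_pow_and_ncard_le (j + 1)).1)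
            (fun j => (finite_pow_and_ncard_le (j + 1)).2.trans (Nat.pow_le_pow_left hPQ _))
            fun x hx => ?_
          obtain ⟨g, hg, rfl⟩ := Finset.mem_image.1 hx
          exact (hℓ _ (hfin g hg w)).1
      _ = 1 := by rw [mul_one, mul_inv_cancel₀ hN0.ne']
  refine (entropy_le_sum_neg_log ν T hT q hq0 hq1).trans ?_
  have hpt : ∀ g ∈ T, ENNReal.ofReal (-Real.log (q g))
      ≤ ENNReal.ofReal (Real.log ((M : ℝ) ^ M) + Real.log (2 * K)) *
        (levelSize m n + ∑ w : Level m n, altLength P Q (sect g w)) := by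
    intro g hg
    have h1 : (levelSize m n : ℝ≥0∞) + ∑ w : Level m n, altLength P Q (sect g w)
        = ENNReal.ofReal (levelSize m n + ∑ w : Level m n, (ℓ (sect g w) : ℝ)) := by
      rw [Finset.sum_congr rfl fun w _ => (hℓ _ (hfin g hg w)).2]
      have h2 : (levelSize m n + ∑ w : Level m n, (ℓ (sect g w) : ℝ))
          = ((levelSize m n + ∑ w : Level m n, ℓ (sect g w) : ℕ) : ℝ) := by push_cast; rfl
      rw [h2, ENNReal.ofReal_natCast]
      push_cast
      rfl
    have h3 : Real.log (q g) = -Real.log N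
        - Real.log (2 * K) * (levelSize m n + ∑ w : Level m n, (ℓ (sect g w) : ℝ)) := by
      rw [hq]
      simp only
      rw [Finset.prod_pow_eq_pow_sum, Real.log_mul (by positivity) (by positivity), Real.log_inv,
        Real.log_pow, hr, Real.log_inv, Finset.sum_add_distrib, Finset.sum_const,
        Finset.card_univ, card_level, smul_eq_mul, mul_one]
      push_cast
      ring
    have h4 : Real.log N ≤ levelSize m n * Real.log ((M : ℝ) ^ M) := by
      rw [← Real.log_pow]
      exact Real.log_le_log hN0 hNle
    have h5 : (0 : ℝ) ≤ ∑ w : Level m n, (ℓ (sect g w) : ℝ) := by positivity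
    rw [h1, ← ENNReal.ofReal_mul (by linarith)]
    refine ENNReal.ofReal_le_ofReal ?_
    rw [h3]
    nlinarith [mul_nonneg hlogM h5]
  calc ∑ g ∈ T, ν g * ENNReal.ofReal (-Real.log (q g))
      ≤ ∑ g ∈ T, ν g * (ENNReal.ofReal (Real.log ((M : ℝ) ^ M) + Real.log (2 * K)) *
        (levelSize m n + ∑ w : Level m n, altLength P Q (sect g w))) :=
        Finset.sum_le_sum fun g hg => mul_le_mul_right (hpt g hg) _
    _ = _ := by
        simp only [mul_left_comm (ν _)]
        rw [← Finset.mul_sum]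
        simp only [mul_add, Finset.sum_add_distrib]
        rw [← Finset.sum_mul, hsum, one_mul]

theorem entropy_convPow_le {M K : ℕ} (hM : ∀ i, m i ≤ M) {𝒜 ℬ : Subgroup (TreeAut m)} [Finite 𝒜]
    (h𝒜 : ∀ a ∈ 𝒜, IsDirected a) (hℬ : ∀ b ∈ ℬ, IsRooted b) (hK : 0 < K)
    (hcard : Nat.card 𝒜 * M ^ M ≤ K) {S : Finset (TreeAut m)} (hS : ∀ s ∈ S, s⁻¹ ∈ S)
    (μ : PMF (TreeAut m)) (hμ : ∀ g, μ g⁻¹ = μ g) (hμS : ∀ g, μ g ≠ 0 → g ∈ S) {n : ℕ}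
    {A B : Set (Level m n)} (h : IsSectionPartition 𝒜 ℬ S n A B) (k : ℕ) :
    entropy (convPow μ k) ≤ ENNReal.ofReal (Real.log ((M : ℝ) ^ M) + Real.log (2 * K)) *
      (levelSize m n + k * effectiveConductance (schreierConductance S n) A B) := by
  have hμ1 : ∑ s ∈ S, μ s = 1 := by
    rw [← μ.tsum_coe, tsum_eq_sum fun g hg => not_not.1 (mt (hμS g) hg)]
  obtain ⟨φ, hφA, -, hφ, hflow⟩ := exists_harmonic_flow_le S hS μ hμ hμ1 n h.disjoint
  obtain ⟨hP, hPcard⟩ := finite_raySections_and_card_le h𝒜 n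
  obtain ⟨hQ, hQcard⟩ := finite_neighbourSections_and_card_le h𝒜 hℬ hM n
  have hfin : μ.support.Finite := S.finite_toSet.subset fun g hg => hμS g hg
  refine (entropy_le_altLength (convPow μ k) (finite_support_convPow μ hfin k) hM hK
    (raySections 𝒜 n) (neighbourSections 𝒜 ℬ n)
    ((Nat.mul_le_mul hPcard hQcard).trans hcard)).trans ?_
  refine mul_le_mul_right (add_le_add_right ?_ _) _
  simp only [Finset.mul_sum]
  rw [Summable.tsum_finsetSum fun _ _ => ENNReal.summable]
  refine (Finset.sum_le_sum fun v _ =>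
    (tsum_convPow_altLength_le h μ hμS hμ1 hφA hφ k v).1).trans ?_
  rw [sum_altBound S μ hμ1]
  exact mul_le_mul_right hflow _

end

end SphericalTree

open SphericalTree
theorem mainTheorem3 (m : ℕ → ℕ) [∀ i, NeZero (m i)] (hm : BddAbove (Set.range m))
    (𝒜 ℬ : Subgroup (TreeAut m)) [Finite 𝒜]
    (h𝒜 : ∀ a ∈ 𝒜, IsDirected a) (hℬ : ∀ b ∈ ℬ, IsRooted b)
    (S : Finset (TreeAut m)) (hS : ∀ s ∈ S, s ∈ principalGroup 𝒜 ℬ)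
    (hS_symm : ∀ s ∈ S, s⁻¹ ∈ S) :
    (∃ (n₀ : ℕ) (F : Set (Level m n₀)), ∀ j : ℕ,
      IsSectionPartition 𝒜 ℬ S (n₀ + (j + 1))
        {v | ∃ w ∈ F, v = append w (zeroWord (shift m n₀) (j + 1))}
        {v | ∃ w ∈ F, ∃ u : Level (shift m n₀) (j + 1),
          IsRayNeighbour u ∧ v = append w u}) ∧
    ∃ C : ℝ≥0, ∀ μ : PMF (TreeAut m),
      (∀ g, μ g⁻¹ = μ g) → (∀ g, μ g ≠ 0 → g ∈ S) →
      ∀ (n : ℕ) (A B : Set (Level m n)), IsSectionPartition 𝒜 ℬ S n A B →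
      ∀ k : ℕ, entropy (convPow μ k) ≤
        (C : ℝ≥0∞) * ((levelSize m n : ℝ≥0∞) +
          (k : ℝ≥0∞) / effectiveResistance (schreierConductance S n) A B) := by
  refine ⟨exists_isSectionPartition h𝒜 hℬ S hS, ?_⟩
  obtain ⟨M, hM⟩ := hm
  have hM' : ∀ i, m i ≤ M := fun i => hM ⟨i, rfl⟩
  have hK : 0 < Nat.card 𝒜 * M ^ M := Nat.mul_pos Nat.card_pos
    ((Nat.pow_pos (Nat.pos_of_neZero (m 0))).trans_le (pow_self_le hM' 0))
  refine ⟨Real.toNNReal (Real.log ((M : ℝ) ^ M) +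
    Real.log (2 * (Nat.card 𝒜 * M ^ M : ℕ))), fun μ hμ hμS n A B h k => ?_⟩
  rw [effectiveResistance, div_eq_mul_inv, inv_inv]
  exact entropy_convPow_le hM' h𝒜 hℬ hK le_rfl hS_symm μ hμ hμS h k
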